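/- **Conventions.** Let $V$ be a finite, linearly ordered set of nodes. All edge matrices are binary. $\operatorname{In}[X]$ replaces every nonzero entry of $X$ by $1$; $X_{ab}$ is the block of $X$ with rows $a$ and columns $b$; ${\cal I}$ is an identity matrix. For a square binary matrix ${\cal F}$, a subset $a$ of its index set and its complement $b$, the partial closure is $$\operatorname{zer}_a{\cal F}=\operatorname{In}\begin{pmatrix}{\cal F}_{aa}^- & {\cal F}_{aa}^-{\cal F}_{ab}\\ {\cal F}_{ba}{\cal F}_{aa}^- & {\cal F}_{bb}+{\cal F}_{ba}{\cal F}_{aa}^-{\cal F}_{ab}\end{pmatrix},\qquad {\cal F}_{aa}^-=\operatorname{In}[((|a|+1){\cal I}_{aa}-{\cal F}_{aa})^{-1}].$$ The nodes of a *summary graph* are $N=u\cup v$ with $u,v$ disjoint. Its edge-matrix components are ${\cal H}_{uu}$ (arrows within $u$; unit upper-triangular), ${\cal H}_{uv}$ (arrows from $v$ to $u$), ${\cal W}_{uu}$ (dashed lines) and ${\cal S}^{vv}$ (full lines); the last two are symmetric with ones along the diagonal. An entry $1$ in position $(i,k)$, $i\ne k$, of ${\cal H}$ is the arrow $i\leftarrow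 k$. For a set $s$ of nodes and $c\subseteq s$, the *foster nodes* of $c$ in $s$ are the nodes of $s\setminus c$ from which a directed path within $s$ leads to a node of $c$. **Summary graph generated from a directed acyclic graph.** Let ${\cal A}$ be the (unit upper-triangular) edge matrix of a directed acyclic graph on $V$, and let $C,M\subseteq V$ be disjoint. Let $F$ be the set of foster nodes of $C$ in $V$, $R=C\cup F$, $O=V\setminus R$, $p=O\cap M$, $q=F\cap M$, $u=O\setminus p$, $v=F\setminus q$, ${\cal D}=\operatorname{zer}_p{\cal A}$, ${\cal S}^{FF.O}=\operatorname{In}[{\cal A}_{RR}^{T}{\cal A}_{RR}]_{FF}$ and $$\operatorname{zer}_q{\cal S}^{FF.O}=\begin{pmatrix}{\cal S}_{qq|vC}&{\cal P}_{q|v.C}\\ \cdot&{\cal S}^{vv.uM}\end{pmatrix}.$$ The graph $G^{V\setminus[C,M]}_{\rm sum}$ has node set $u\cup v$ and the components ${\cal H}_{uu}={\cal D}_{uu}$, ${\cal H}_{uv}=\operatorname{In}[{\cal D}_{uv}+{\cal D}_{uq}{\cal P}_{q|v.C}]$, ${\cal S}^{vv.uM}$ and ${\cal W}_{uu}=\operatorname{In}[{\cal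 I}_{uu}+{\cal D}_{up}{\cal D}_{up}^{T}+{\cal D}_{uq}{\cal S}_{qq|vC}{\cal D}_{uq}^{T}]$. **Reduction of a summary graph.** Let $G$ be a summary graph with nodes $\mu\cup\nu$ (in place of $u\cup v$) and components ${\cal B}_{\mu\mu},{\cal B}_{\mu\nu},{\cal W}'_{\mu\mu},{\cal S}^{\nu\nu}$ (arrows within $\mu$, arrows from $\nu$ to $\mu$, dashed lines, full lines), and let $c',m'$ be disjoint subsets of its nodes. Let $c_\mu=c'\cap\mu$, let $f_\mu$ be the set of foster nodes of $c_\mu$ in $\mu$, and put $r=c_\mu\cup f_\mu$, $o=\mu\setminus r$, $\psi=r\cup\nu$, $\phi=\psi\setminus c'$, $h=o\cap m'$, $l=\phi\cap m'$, $u=o\setminus h$, $v=\phi\setminus l$. Let $${\cal Q}=\operatorname{zer}_r{\cal W}'_{\mu\mu},\qquad {\cal C}_{o\psi}=\operatorname{In}[{\cal B}_{o\psi}+{\cal Q}_{or}{\cal B}_{r\psi}],\qquad {\cal K}=\operatorname{zer}_{h\cup l}\begin{pmatrix}{\cal B}_{oo}&{\cal C}_{o\phi}\\0&{\cal S}^{\phi\phi}\end{pmatrix},$$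 where ${\cal S}^{\phi\phi}$ is the $\phi\phi$-block of $${\cal S}^{\psi\psi}=\operatorname{In}\begin{pmatrix}{\cal B}_{rr}^T{\cal Q}_{rr}{\cal B}_{rr}&{\cal B}_{rr}^T{\cal Q}_{rr}{\cal B}_{r\nu}\\ \cdot&{\cal S}^{\nu\nu}+{\cal B}_{r\nu}^T{\cal Q}_{rr}{\cal B}_{r\nu}\end{pmatrix}$$ in the order $\psi=(r,\nu)$. Let ${\cal S}_{ll|vC}$ and ${\cal S}^{vv.uM}$ be the $ll$- and the $vv$-block of $\operatorname{zer}_l{\cal S}^{\phi\phi}$. The *reduction* of $G$ by $[c',m']$ has node set $u\cup v$ and the components ${\cal K}_{uu}$, ${\cal K}_{uv}$, ${\cal S}^{vv.uM}$ and $${\cal W}_{uu}=\operatorname{In}[{\cal Q}_{uu}+{\cal K}_{uh}{\cal Q}_{hu}+{\cal Q}_{uh}{\cal K}_{uh}^T+{\cal K}_{uh}{\cal Q}_{hh}{\cal K}_{uh}^T+{\cal K}_{ul}{\cal S}_{ll|vC}{\cal K}_{ul}^T].$$ **Corollary 5.** 1. Let ${\cal A}$ be the edge matrix of a directed acyclic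 graph on $V$, $c\subseteq C\subseteq V$ and $m\subseteq M\subseteq V$ with $C\cap M=\varnothing$. Then $G^{V\setminus[C,M]}_{\rm sum}$ is a summary graph with node set $V\setminus(C\cup M)$, and it equals the reduction of $G^{V\setminus[c,m]}_{\rm sum}$ by $[C\setminus c,\,M\setminus m]$: the sets $u,v$ and all four edge-matrix components coincide. 2. Hence summary graphs are closed under marginalising and conditioning, in any order: for every summary graph $G$ with node set $N$ and disjoint $c',m'\subseteq N$, the reduction of $G$ by $[c',m']$ is a summary graph with node set $N\setminus(c'\cup m')$; and for pairwise disjoint $c_1,m_1,c_2,m_2\subseteq N$, reducing $G$ by $[c_1,m_1]$ and the result by $[c_2,m_2]$ gives the same graph as reducing $G$ by $[c_1\cup c_2,m_1\cup m_2]$. -/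

import Mathlib

/-! All edge matrices are indexed by one ambient finite node set `V`, linearly ordered so that
arrows point from larger to smaller nodes (`i ← k` only if `i < k`). The block `X_ab` of a matrix
`X` is stored as the `V × V` matrix `blk a b X` that agrees with `X` on `a × b` and vanishes
elsewhere; products and sums of such padded matrices are the padded block products and sums. -/

noncomputable section

open scoped Matrix

namespace SummaryGraphs

variable {V : Type*}

/-- The indicator function `In[X]`: every nonzero entry is changed into a one. -/
def ind (X : Matrix V V ℝ) : Matrix V V ℝ :=
  fun i j => if X i j = 0 then 0 else 1

/-- The block `X_ab`, padded with zeros. -/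
def blk [DecidableEq V] (a b : Finset V) (X : Matrix V V ℝ) : Matrix V V ℝ :=
  fun i j => if i ∈ a ∧ j ∈ b then X i j else 0

/-- `F_aa⁻ = In[(n I_aa - F_aa)⁻¹]` with `n = |a| + 1`, padded with zeros. The inverse is
taken of the `V × V` matrix `n I - F_aa`, which is block diagonal, so that the `aa`-block of the
inverse is the inverse of the `aa`-block. -/
def closedBlock [Fintype V] [DecidableEq V] (a : Finset V) (F : Matrix V V ℝ) :
    Matrix V V ℝ :=
  ind (blk a a ((((a.card : ℝ) + 1) • (1 : Matrix V V ℝ) - blk a a F)⁻¹))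

/-- Partial closure `zer_a F`. With `b = V \ a`, its four blocks are `In` of
`F_aa⁻`, `F_aa⁻ F_ab`, `F_ba F_aa⁻` and `F_bb + F_ba F_aa⁻ F_ab`. -/
def zer [Fintype V] [DecidableEq V] (a : Finset V) (F : Matrix V V ℝ) : Matrix V V ℝ :=
  ind (closedBlock a F
    + closedBlock a F * blk a aᶜ F
    + blk aᶜ a F * closedBlock a F
    + ind (blk aᶜ aᶜ F + blk aᶜ a F * closedBlock a F * blk a aᶜ F))

/-- `k` is an ancestor of `i` within the node set `s`: there is a direction-preserving path
`i ← ⋯ ← k` with all nodes in `s`, of at least one arrow, where `i ← k` means `X i k ≠ 0`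
and `i ≠ k`. -/
def IsAncestor (X : Matrix V V ℝ) (s : Finset V) (i k : V) : Prop :=
  Relation.TransGen (fun i k => i ∈ s ∧ k ∈ s ∧ i ≠ k ∧ X i k ≠ 0) i k

open Classical in
/-- The foster nodes of `c` within `s`: the nodes of `s` outside `c` that are
ancestors, within `s`, of some node of `c`. -/
def foster (X : Matrix V V ℝ) (s c : Finset V) : Finset V :=
  s.filter (fun k => k ∉ c ∧ ∃ i ∈ c, IsAncestor X s i k)

/-- The edge matrix of a directed acyclic graph (parent graph) with node set `V`: binary, unit
upper-triangular. -/
structure IsParentEdgeMatrix [LinearOrder V] (A : Matrix V V ℝ) : Prop where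
  binary : ∀ i k, A i k = 0 ∨ A i k = 1
  diag : ∀ i, A i i = 1
  upper : ∀ i k, k < i → A i k = 0

/-- Edge matrix components of a graph on the nodes `(u, v)`: arrows
`dir = (H_uu, H_uv)` (entry `(i, k)` for `i ← k`), dashed lines `dash = W_uu`,
full lines `full = S^vv`. -/
@[ext]
structure EdgeMatrices (V : Type*) where
  u : Finset V
  v : Finset V
  dir : Matrix V V ℝ
  dash : Matrix V V ℝ
  full : Matrix V V ℝ

/-- A summary graph: `u` and `v` are disjoint; within `u` there is a directed acyclic graph
(compatible with the order of `V`) and a covariance graph, within `v` a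
concentration graph, and between `u` and `v` only arrows from `v` to `u`.
Edge matrices are binary and have ones along the diagonal. -/
structure IsSummaryGraph [LinearOrder V] (G : EdgeMatrices V) : Prop where
  disjoint : Disjoint G.u G.v
  dir_binary : ∀ i k, G.dir i k = 0 ∨ G.dir i k = 1
  dash_binary : ∀ i k, G.dash i k = 0 ∨ G.dash i k = 1
  full_binary : ∀ i k, G.full i k = 0 ∨ G.full i k = 1
  dir_supp : ∀ i k, G.dir i k ≠ 0 → i ∈ G.u ∧ k ∈ G.u ∪ G.v
  dash_supp : ∀ i k, G.dash i k ≠ 0 → i ∈ G.u ∧ k ∈ G.u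
  full_supp : ∀ i k, G.full i k ≠ 0 → i ∈ G.v ∧ k ∈ G.v
  dir_diag : ∀ i ∈ G.u, G.dir i i = 1
  dash_diag : ∀ i ∈ G.u, G.dash i i = 1
  full_diag : ∀ i ∈ G.v, G.full i i = 1
  dir_upper : ∀ i ∈ G.u, ∀ k ∈ G.u, k < i → G.dir i k = 0
  dash_symm : ∀ i k, G.dash i k = G.dash k i
  full_symm : ∀ i k, G.full i k = G.full k i

/-! ### The summary graph generated from a parent graph -/

/-- The summary graph for `[C, M]` generated from the parent graph with edge matrix `A` by
conditioning on `C` and marginalising over `M`. Here `F` are the foster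
nodes of `C`, `R = C ∪ F`, `O = V \ R`, `M = p ∪ q` with `p ⊆ O` and `q ⊆ F`, and
`S^{FF.O}` is the `FF`-block of `S^{RR.O} = In[A_RRᵀ A_RR]`. -/
def ofParent [Fintype V] [LinearOrder V] (A : Matrix V V ℝ) (C M : Finset V) :
    EdgeMatrices V :=
  let F := foster A Finset.univ C
  let R := C ∪ F
  let O := Rᶜ
  let p := O ∩ M
  let q := F ∩ M
  let u := O \ p
  let v := F \ q
  let D := zer p A
  -- blocks of `Z`: `S_{qq|vC}`, `P_{q|v.C}` and `S^{vv.qO} = S^{vv.uM}`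
  let Z := zer q (blk F F (ind ((blk R R A)ᵀ * blk R R A)))
  { u := u
    v := v
    dir := blk u u D + ind (blk u v D + blk u q D * blk q v Z)
    dash := ind ((blk u u 1 + blk u p D * (blk u p D)ᵀ)
      + blk u q D * blk q q Z * (blk u q D)ᵀ)
    full := blk v v Z }

/-! ### Generating a summary graph from a larger summary graph

`G` has nodes `(μ, ν) = (G.u, G.v)`, arrows `B = G.dir`, dashed lines `W' = G.dash`, and full
lines `S^{νν.μm} = G.full`. The additional conditioning set is `c` and the additional
marginalising set is `m`. -/

namespace EdgeMatrices

variable [Fintype V] [LinearOrder V] (G : EdgeMatrices V) (c m : Finset V)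

/-- The node set `N = u ∪ v`. -/
def nodes (G : EdgeMatrices V) : Finset V := G.u ∪ G.v

/-- `r = c_μ ∪ f_μ`, with `c_μ = c ∩ μ` and `f_μ` its foster nodes in `μ`. -/
def rSet : Finset V := (c ∩ G.u) ∪ foster G.dir G.u (c ∩ G.u)

/-- The outsiders `o = μ \ r`. -/
def oSet : Finset V := G.u \ G.rSet c

/-- `ψ = r ∪ ν`. -/
def psiSet : Finset V := G.rSet c ∪ G.v

/-- `φ = ψ \ c`. -/
def phiSet : Finset V := G.psiSet c \ c

/-- `h`, the part of the marginalising set within `o`. -/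
def hSet : Finset V := G.oSet c ∩ m

/-- `l`, the part of the marginalising set within `φ`. -/
def lSet : Finset V := G.phiSet c ∩ m

/-- The new `u = o \ h`. -/
def uSet : Finset V := G.oSet c \ G.hSet c m

/-- The new `v = φ \ l`. -/
def vSet : Finset V := G.phiSet c \ G.lSet c m

/-- `Q_μμ = zer_r W'_μμ`. -/
def Q : Matrix V V ℝ := zer (G.rSet c) G.dash

/-- `C_oψ = In[B_oψ + Q_or B_rψ]`. -/
def Cmat : Matrix V V ℝ :=
  ind (blk (G.oSet c) (G.psiSet c) G.dir
    + blk (G.oSet c) (G.rSet c) (G.Q c) * blk (G.rSet c) (G.psiSet c) G.dir)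

/-- `S^{ψψ.om}`: `In` of the matrix with blocks `B_rrᵀ Q_rr B_rr`,
`B_rrᵀ Q_rr B_rν` and `S^{νν.μm} + B_rνᵀ Q_rr B_rν` in the order `ψ = (r, ν)`. -/
def Spsi : Matrix V V ℝ :=
  ind (G.full + (blk (G.rSet c) (G.psiSet c) G.dir)ᵀ
    * blk (G.rSet c) (G.rSet c) (G.Q c) * blk (G.rSet c) (G.psiSet c) G.dir)

/-- `K = zer_{hl}` of the block-triangular matrix with blocks `B_oo`, `C_oφ`, `0`,
`S^{φφ.om}`. -/
def K : Matrix V V ℝ :=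
  zer (G.hSet c m ∪ G.lSet c m)
    (blk (G.oSet c) (G.oSet c) G.dir + blk (G.oSet c) (G.phiSet c) (G.Cmat c)
      + blk (G.phiSet c) (G.phiSet c) (G.Spsi c))

/-- `zer_l S^{φφ.om}`, with `ll`-block `S_{ll|vC}` and `vv`-block `S^{vv.uM}`. -/
def Z : Matrix V V ℝ :=
  zer (G.lSet c m) (blk (G.phiSet c) (G.phiSet c) (G.Spsi c))

/-- The edge matrix components obtained from those of `G` by additional conditioning on `c` and
marginalising over `m`: `K_uu`, `K_uv`, `S^{vv.uM}` and
`W_uu = In[Q_uu + K_uh Q_hu + Q_uh K_uhᵀ + K_uh Q_hh K_uhᵀ + K_ul S_{ll|vC} K_ulᵀ]`. -/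
def reduce : EdgeMatrices V :=
  let h := G.hSet c m
  let l := G.lSet c m
  let u := G.uSet c m
  let v := G.vSet c m
  { u := u
    v := v
    dir := blk u u (G.K c m) + blk u v (G.K c m)
    dash := ind (blk u u (G.Q c)
      + blk u h (G.K c m) * blk h u (G.Q c)
      + blk u h (G.Q c) * (blk u h (G.K c m))ᵀ
      + blk u h (G.K c m) * blk h h (G.Q c) * (blk u h (G.K c m))ᵀ
      + blk u l (G.K c m) * blk l l (G.Z c m) * (blk u l (G.K c m))ᵀ)
    full := blk v v (G.Z c m) }

end EdgeMatrices

end SummaryGraphs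

end

open scoped Matrix

set_option linter.unusedSectionVars false

namespace SummaryGraphs

/-! ### Supports of entrywise nonnegative matrices -/

/-! All matrices that occur under `In` here may be taken entrywise nonnegative, so a sum has the
union of the supports and a product the composition of the relations. Binary matrices are determined
by their supports (`eq_of_binary`), and `zer_ne_zero` reads the partial closure as the existence of
a path whose inner nodes lie in the closed set. The theorem thus becomes a statement about paths.

To treat the three kinds of edges at once, each node is split into a residual and a variable, which
gives one symmetric adjacency `splitAdj`. Conditioning lets paths run through the residuals of `r`;
marginalising within `φ` lets them run through the variables of `l`. These paths form `Core`. A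
marginalised node of `o` is instead replaced by its parents, so it is traversed only against the
arrows, by a `Chain` attached to a residual at an end of the path. Together they form `Full`, and
`reduce_splitAdj` shows that the reduced graph is `Full` restricted to the surviving split vertices.

For two successive reductions the delicate nodes are those of `m₁` outside `r` for `c₁` but inside
`r` for `c₁ ∪ c₂`: they belong to chains in the first step, but to core paths of the joint
reduction. `chain_of_chain` turns a chain step at such a node into the detour residual, variable,
residual. Conversely, `core_reduce_of_core` cuts a joint path at vertices surviving the first step.
This gives `reduce_reduce`.

A directed acyclic graph is itself a summary graph, with empty `v` and identity dashed matrix, and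
`ofParent_eq_reduce` identifies the generated graph with its reduction. The first claim is then an
instance of `reduce_reduce`. -/

/-- All entries are nonnegative. -/
class NonnegEntries {V : Type*} (X : Matrix V V ℝ) : Prop where
  nonneg : ∀ i j, 0 ≤ X i j

section Support

variable {V : Type*}

instance (X : Matrix V V ℝ) : NonnegEntries (ind X) :=
  ⟨fun i j => by unfold ind; split_ifs <;> norm_num⟩

instance [DecidableEq V] (a b : Finset V) (X : Matrix V V ℝ) [h : NonnegEntries X] :
    NonnegEntries (blk a b X) :=
  ⟨fun i j => by unfold blk; split_ifs; exacts [h.nonneg i j, le_rfl]⟩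

instance (X Y : Matrix V V ℝ) [hX : NonnegEntries X] [hY : NonnegEntries Y] :
    NonnegEntries (X + Y) :=
  ⟨fun i j => add_nonneg (hX.nonneg i j) (hY.nonneg i j)⟩

instance [Fintype V] (X Y : Matrix V V ℝ) [hX : NonnegEntries X] [hY : NonnegEntries Y] :
    NonnegEntries (X * Y) :=
  ⟨fun i j => Finset.sum_nonneg fun k _ => mul_nonneg (hX.nonneg i k) (hY.nonneg k j)⟩

instance (X : Matrix V V ℝ) [hX : NonnegEntries X] : NonnegEntries Xᵀ :=
  ⟨fun i j => hX.nonneg j i⟩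

instance [DecidableEq V] : NonnegEntries (1 : Matrix V V ℝ) :=
  ⟨fun i j => by rw [Matrix.one_apply]; split_ifs <;> norm_num⟩

instance [Fintype V] [DecidableEq V] (a : Finset V) (F : Matrix V V ℝ) :
    NonnegEntries (closedBlock a F) := by unfold closedBlock; infer_instance

instance [Fintype V] [DecidableEq V] (a : Finset V) (F : Matrix V V ℝ) :
    NonnegEntries (zer a F) := by unfold zer; infer_instance

theorem nonnegEntries_of_binary {X : Matrix V V ℝ} (h : ∀ i j, X i j = 0 ∨ X i j = 1) :
    NonnegEntries X :=
  ⟨fun i j => by rcases h i j with h | h <;> rw [h]; exact zero_le_one⟩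

theorem ind_ne_zero {X : Matrix V V ℝ} {i j : V} : ind X i j ≠ 0 ↔ X i j ≠ 0 := by
  unfold ind; split_ifs with h <;> simp [h]

theorem ind_binary (X : Matrix V V ℝ) (i j : V) : ind X i j = 0 ∨ ind X i j = 1 := by
  unfold ind; split_ifs <;> simp

theorem blk_ne_zero [DecidableEq V] {a b : Finset V} {X : Matrix V V ℝ} {i j : V} :
    blk a b X i j ≠ 0 ↔ i ∈ a ∧ j ∈ b ∧ X i j ≠ 0 := by
  unfold blk; split_ifs with h
  · simp [h.1, h.2]
  · simp only [ne_eq, not_true_eq_false, false_iff]; tauto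

theorem blk_binary [DecidableEq V] {a b : Finset V} {X : Matrix V V ℝ} {i j : V}
    (h : X i j = 0 ∨ X i j = 1) : blk a b X i j = 0 ∨ blk a b X i j = 1 := by
  unfold blk; split_ifs <;> simp [h]

theorem add_ne_zero {X Y : Matrix V V ℝ} [hX : NonnegEntries X] [hY : NonnegEntries Y] {i j : V} :
    (X + Y) i j ≠ 0 ↔ X i j ≠ 0 ∨ Y i j ≠ 0 := by
  rw [Matrix.add_apply, Ne, add_eq_zero_iff_of_nonneg (hX.nonneg i j) (hY.nonneg i j)]
  tauto

theorem mul_ne_zero [Fintype V] {X Y : Matrix V V ℝ} [hX : NonnegEntries X]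
    [hY : NonnegEntries Y] {i j : V} :
    (X * Y) i j ≠ 0 ↔ ∃ k, X i k ≠ 0 ∧ Y k j ≠ 0 := by
  rw [Matrix.mul_apply, Ne, Finset.sum_eq_zero_iff_of_nonneg
    fun k _ => mul_nonneg (hX.nonneg i k) (hY.nonneg k j)]
  simp

theorem transpose_ne_zero {X : Matrix V V ℝ} {i j : V} : Xᵀ i j ≠ 0 ↔ X j i ≠ 0 := Iff.rfl

theorem one_ne_zero_iff [DecidableEq V] {i j : V} : (1 : Matrix V V ℝ) i j ≠ 0 ↔ i = j := by
  rw [Matrix.one_apply]; split_ifs with h <;> simp [h]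

theorem eq_of_binary {X Y : Matrix V V ℝ} (hX : ∀ i j, X i j = 0 ∨ X i j = 1)
    (hY : ∀ i j, Y i j = 0 ∨ Y i j = 1) (h : ∀ i j, X i j ≠ 0 ↔ Y i j ≠ 0) : X = Y := by
  ext i j
  have := h i j
  rcases hX i j with h1 | h1 <;> rcases hY i j with h2 | h2 <;> simp_all

theorem binary_le_one {X : Matrix V V ℝ} (h : ∀ i j, X i j = 0 ∨ X i j = 1) (i j : V) :
    X i j ≤ 1 := by
  rcases h i j with h | h <;> rw [h]; exact zero_le_one

end Support

/-! ### Paths through a given set -/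

section Thru

variable {α : Type*}

/-- There is an `R`-path from `i` to `j`, of at least one step, all of whose inner nodes
satisfy `s`. -/
def Thru (s : α → Prop) (R : α → α → Prop) (i j : α) : Prop :=
  ∃ z, Relation.ReflTransGen (fun p q => R p q ∧ s q) i z ∧ R z j

variable {s t : α → Prop} {R R' : α → α → Prop} {i j k : α}

theorem Thru.single (h : R i j) : Thru s R i j := ⟨i, .refl, h⟩

theorem Thru.tail (h : Thru s R i j) (hj : s j) (hk : R j k) : Thru s R i k := by
  obtain ⟨z, hz, hzj⟩ := h
  exact ⟨j, hz.tail ⟨hzj, hj⟩, hk⟩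

theorem Thru.trans (h : Thru s R i j) (hj : s j) (h' : Thru s R j k) : Thru s R i k := by
  obtain ⟨z, hz, hzj⟩ := h
  obtain ⟨w, hw, hwk⟩ := h'
  exact ⟨w, (hz.tail ⟨hzj, hj⟩).trans hw, hwk⟩

theorem Thru.induction {P : α → Prop} (h : Thru s R i j) (base : ∀ x, R i x → P x)
    (step : ∀ x y, P x → s x → R x y → P y) : P j := by
  obtain ⟨z, hz, hzj⟩ := h
  induction hz generalizing j with
  | refl => exact base _ hzj
  | tail _ hbc ih => exact step _ _ (ih hbc.1) hbc.2 hzj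

theorem Thru.mono (hs : ∀ x, s x → t x) (hR : ∀ x y, R x y → R' x y) (h : Thru s R i j) :
    Thru t R' i j :=
  h.induction (fun _ hx => .single (hR _ _ hx)) fun _ _ hx hs' hxy => hx.tail (hs _ hs') (hR _ _ hxy)

theorem Thru.symm (hR : ∀ x y, R x y → R y x) (h : Thru s R i j) : Thru s R j i :=
  h.induction (P := fun j => Thru s R j i) (fun _ hx => .single (hR _ _ hx))
    fun x _ hx hs hxy => Thru.trans (.single (hR _ _ hxy)) hs hx

theorem thru_iff_head : Thru s R i j ↔ R i j ∨ ∃ x, R i x ∧ s x ∧ Thru s R x j := by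
  constructor
  · intro h
    refine h.induction (P := fun j => R i j ∨ ∃ x, R i x ∧ s x ∧ Thru s R x j)
      (fun x hx => .inl hx) ?_
    rintro x y (h | ⟨w, h1, h2, h3⟩) hx hxy
    · exact .inr ⟨x, h, hx, .single hxy⟩
    · exact .inr ⟨w, h1, h2, h3.tail hx hxy⟩
  · rintro (h | ⟨x, h1, h2, h3⟩)
    exacts [.single h, Thru.trans (.single h1) h2 h3]

theorem thru_iff_tail : Thru s R i j ↔ R i j ∨ ∃ x, Thru s R i x ∧ s x ∧ R x j := by
  constructor
  · intro h
    exact h.induction (P := fun j => R i j ∨ ∃ x, Thru s R i x ∧ s x ∧ R x j)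
      (fun x hx => .inl hx) fun x y h hx hxy => .inr
      ⟨x, h.elim .single fun ⟨w, h1, h2, h3⟩ => h1.tail h2 h3, hx, hxy⟩
  · rintro (h | ⟨x, h1, h2, h3⟩)
    exacts [.single h, h1.tail h2 h3]

/-- Cutting a path at its inner nodes in `t` leaves segments whose inner nodes lie in `s`; closing
over a union can therefore be done in two stages. -/
theorem thru_or : Thru (fun x => s x ∨ t x) R i j ↔ Thru t (Thru s R) i j := by
  constructor
  · intro h
    refine h.induction (fun x hx => .single (.single hx)) ?_
    rintro x y h (hx | hx) hxy
    · rcases thru_iff_tail.1 h with h | ⟨w, h1, h2, h3⟩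
      · exact .single (h.tail hx hxy)
      · exact h1.tail h2 (h3.tail hx hxy)
    · exact h.tail hx (.single hxy)
  · intro h
    refine h.induction (fun x hx => hx.mono (fun _ => .inl) fun _ _ => id) ?_
    intro x y h hx hxy
    exact h.trans (.inr hx) (hxy.mono (fun _ => .inl) fun _ _ => id)


end Thru

/-! ### The partial closure -/

section Zer

variable {V : Type*} [Fintype V] [DecidableEq V]

/-- The row sums of the padded block are at most `|a|`, so `(|a| + 1) I - F_aa` is strictly
diagonally dominant with nonpositive off-diagonal entries. A maximum principle yields its
invertibility, the nonnegativity of the inverse, and the vanishing of the inverse where no path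
exists; paths force positivity through `N * N⁻¹ = 1`. -/
theorem closedBlock_ne_zero {a : Finset V} {F : Matrix V V ℝ} [hF : NonnegEntries F]
    (hF1 : ∀ i j, F i j ≤ 1) {i j : V} :
    closedBlock a F i j ≠ 0 ↔ i ∈ a ∧ j ∈ a ∧
      Relation.ReflTransGen (fun p q => F p q ≠ 0 ∧ q ∈ a) i j := by
  set B := blk a a F with hB
  have hBn : NonnegEntries B := inferInstance
  set N : Matrix V V ℝ := ((a.card : ℝ) + 1) • (1 : Matrix V V ℝ) - B with hN
  have hrow : ∀ i, ∑ k, B i k ≤ a.card := by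
    intro i
    calc ∑ k, B i k ≤ ∑ k, if k ∈ a then (1 : ℝ) else 0 := by
          refine Finset.sum_le_sum fun k _ => ?_
          by_cases hk : k ∈ a
          · by_cases hi : i ∈ a <;> simp [hB, blk, hk, hi, hF1]
          · simp [hB, blk, hk]
      _ = a.card := by simp
  -- maximum principle
  have hmax : ∀ (T : Finset V) (x : V → ℝ),
      (∀ i ∈ T, ((a.card : ℝ) + 1) * x i ≤ ∑ k, B i k * x k) →
      (∀ i ∈ T, ∀ k, k ∉ T → B i k * x k ≤ 0) → ∀ i ∈ T, x i ≤ 0 := by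
    intro T x h1 h2
    by_contra! hcon
    obtain ⟨i0, hi0, hpos⟩ := hcon
    obtain ⟨i, hi, him⟩ := Finset.exists_max_image T x ⟨i0, hi0⟩
    have hxi : 0 < x i := hpos.trans_le (him i0 hi0)
    have h3 : ∑ k, B i k * x k ≤ ∑ k, B i k * x i := by
      refine Finset.sum_le_sum fun k _ => ?_
      by_cases hk : k ∈ T
      · exact mul_le_mul_of_nonneg_left (him k hk) (hBn.nonneg i k)
      · exact (h2 i hi k hk).trans (mul_nonneg (hBn.nonneg i k) hxi.le)
    rw [← Finset.sum_mul] at h3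
    nlinarith [h1 i hi, mul_le_mul_of_nonneg_right (hrow i) hxi.le]
  have hNmul : ∀ (x : V → ℝ) i, (N *ᵥ x) i = ((a.card : ℝ) + 1) * x i - ∑ k, B i k * x k := by
    intro x i
    rw [hN, Matrix.sub_mulVec, Matrix.smul_mulVec, Matrix.one_mulVec]
    rfl
  have hunit : IsUnit N.det := by
    rw [isUnit_iff_ne_zero]
    intro h0
    obtain ⟨x, hx0, hx⟩ := Matrix.exists_mulVec_eq_zero_iff.2 h0
    apply hx0
    -- Applied to a kernel vector and to its negative, this forces the vector to vanish.
    have key : ∀ y : V → ℝ, N *ᵥ y = 0 → ∀ i, y i ≤ 0 := by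
      intro y hy i
      refine hmax Finset.univ y (fun i _ => ?_) (fun i _ k hk => absurd (Finset.mem_univ k) hk) i
        (Finset.mem_univ i)
      have := congrFun hy i
      rw [hNmul] at this
      simp only [Pi.zero_apply] at this
      linarith
    ext i
    have h1 := key x hx i
    have h2 := key (-x) (by rw [Matrix.mulVec_neg, hx, neg_zero]) i
    simp only [Pi.neg_apply, Pi.zero_apply] at h2 ⊢
    linarith
  set X := N⁻¹ with hX
  have hNX : N * X = 1 := Matrix.mul_nonsing_inv N hunit
  have heq : ∀ i j, ((a.card : ℝ) + 1) * X i j = (1 : Matrix V V ℝ) i j + ∑ k, B i k * X k j := by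
    intro i j
    have h1 := hNmul (fun k => X k j) i
    have h2 : (N *ᵥ fun k => X k j) i = (N * X) i j := rfl
    rw [h2, hNX] at h1
    linarith
  have hone : ∀ i j, 0 ≤ (1 : Matrix V V ℝ) i j :=
    (inferInstance : NonnegEntries (1 : Matrix V V ℝ)).nonneg
  have hXn : ∀ i j, 0 ≤ X i j := by
    intro i j
    have := hmax Finset.univ (fun k => - X k j) (fun i _ => by
      have h1 := heq i j
      have h2 := hone i j
      simp only [mul_neg, Finset.sum_neg_distrib]
      linarith) (fun i _ k hk => absurd (Finset.mem_univ k) hk) i (Finset.mem_univ i)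
    linarith
  have hcard : (0 : ℝ) < (a.card : ℝ) + 1 := by positivity
  have hstep : ∀ i k j, B i k ≠ 0 → X k j ≠ 0 → X i j ≠ 0 := by
    intro i k j h1 h2 h3
    have h4 := heq i j
    have h5 : 0 < B i k * X k j :=
      mul_pos ((hBn.nonneg i k).lt_of_ne' h1) ((hXn k j).lt_of_ne' h2)
    have h6 : B i k * X k j ≤ ∑ k, B i k * X k j :=
      Finset.single_le_sum (f := fun k => B i k * X k j)
        (fun k _ => mul_nonneg (hBn.nonneg i k) (hXn k j)) (Finset.mem_univ k)
    have := hone i j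
    rw [h3, mul_zero] at h4
    linarith
  have hdiag : ∀ j, X j j ≠ 0 := by
    intro j h3
    have h4 := heq j j
    have h6 : 0 ≤ ∑ k, B j k * X k j :=
      Finset.sum_nonneg (fun k _ => mul_nonneg (hBn.nonneg j k) (hXn k j))
    rw [h3, mul_zero, Matrix.one_apply_eq] at h4
    linarith
  have hsupp : ∀ i j, X i j ≠ 0 ↔ Relation.ReflTransGen (fun p q => B p q ≠ 0) i j := by
    classical
    intro i j
    constructor
    · intro h
      by_contra hcon
      apply h
      refine le_antisymm ?_ (hXn i j)
      -- The maximum principle is used on the nodes from which `j` cannot be reached: no edge leaves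
      -- this set, and it omits `j`, so the identity contributes nothing there.
      refine hmax (Finset.univ.filter fun i => ¬ Relation.ReflTransGen (fun p q => B p q ≠ 0) i j)
        (fun k => X k j) ?_ ?_ i (by simpa using hcon)
      · intro i hi
        rw [heq, Matrix.one_apply_ne, zero_add]
        rintro rfl
        simp [Relation.ReflTransGen.refl] at hi
      · intro i hi k hk
        simp only [Finset.mem_filter, Finset.mem_univ, true_and, not_not] at hi hk
        by_cases hik : B i k = 0
        · simp [hik]
        · exact absurd (Relation.ReflTransGen.head hik hk) hi
    · intro h
      induction h using Relation.ReflTransGen.head_induction_on with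
      | refl => exact hdiag j
      | head hab _ ih => exact hstep _ _ _ hab ih
  have hdef : closedBlock a F = ind (blk a a X) := rfl
  rw [hdef, ind_ne_zero, blk_ne_zero, hsupp]
  refine and_congr_right fun hi => and_congr_right fun hj => ⟨fun h => ?_, fun h => ?_⟩
  · exact Relation.ReflTransGen.mono (fun p q hpq => ⟨(blk_ne_zero.1 hpq).2.2, (blk_ne_zero.1 hpq).2.1⟩) _ _ h
  · clear hj
    have : i ∈ a ∧ j ∈ a ∧ Relation.ReflTransGen (fun p q => B p q ≠ 0) i j := by
      induction h with
      | refl => exact ⟨hi, hi, .refl⟩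
      | tail _ hbc ih =>
        exact ⟨hi, hbc.2, ih.2.2.tail (blk_ne_zero.2 ⟨ih.2.1, hbc.2, hbc.1⟩)⟩
    exact this.2.2

theorem zer_binary (a : Finset V) (F : Matrix V V ℝ) (i j : V) :
    zer a F i j = 0 ∨ zer a F i j = 1 := ind_binary _ i j

/-- The four blocks only record which endpoints lie in `a`. The separate diagonal case comes from
the empty path inside the closed block. -/
theorem zer_ne_zero {a : Finset V} {F : Matrix V V ℝ} [hF : NonnegEntries F]
    (hF1 : ∀ i j, F i j ≤ 1) {i j : V} :
    zer a F i j ≠ 0 ↔ (i = j ∧ i ∈ a) ∨ Thru (· ∈ a) (fun p q => F p q ≠ 0) i j := by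
  unfold zer
  simp only [ind_ne_zero, add_ne_zero, mul_ne_zero, blk_ne_zero, closedBlock_ne_zero hF1,
    Finset.mem_compl]
  have haa : ∀ {x z}, Relation.ReflTransGen (fun p q => F p q ≠ 0 ∧ q ∈ a) x z → x ∈ a → z ∈ a := by
    intro x z h hx
    rcases Relation.ReflTransGen.cases_tail h with rfl | ⟨c, -, -, h⟩
    exacts [hx, h]
  constructor
  · rintro (((⟨hi, hj, h⟩ | ⟨k, ⟨hi, hk, h⟩, -, hj, hkj⟩) | ⟨k, ⟨hi, hk, hik⟩, -, hj, h⟩) |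
      ⟨hi, hj, h⟩ | ⟨k, ⟨l, ⟨hi, hl, hil⟩, -, hk, hlk⟩, -, hj, hkj⟩)
    · rcases Relation.ReflTransGen.cases_tail h with rfl | ⟨c, h1, h2, h3⟩
      exacts [.inl ⟨rfl, hi⟩, .inr ⟨c, h1, h2⟩]
    · exact .inr ⟨k, h, hkj⟩
    · rcases Relation.ReflTransGen.cases_tail h with rfl | ⟨c, h1, h2, h3⟩
      exacts [.inr (.single hik), .inr ⟨c, .head ⟨hik, hk⟩ h1, h2⟩]
    · exact .inr (.single h)
    · exact .inr ⟨k, .head ⟨hil, hl⟩ hlk, hkj⟩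
  · rintro (⟨rfl, hi⟩ | ⟨z, hz, hzj⟩)
    · exact .inl (.inl (.inl ⟨hi, hi, .refl⟩))
    · by_cases hi : i ∈ a
      · have hza := haa hz hi
        by_cases hj : j ∈ a
        · exact .inl (.inl (.inl ⟨hi, hj, hz.tail ⟨hzj, hj⟩⟩))
        · exact .inl (.inl (.inr ⟨z, ⟨hi, hza, hz⟩, hza, hj, hzj⟩))
      · rcases Relation.ReflTransGen.cases_head hz with rfl | ⟨x, ⟨hix, hx⟩, hxz⟩
        · by_cases hj : j ∈ a
          · exact .inl (.inr ⟨j, ⟨hi, hj, hzj⟩, hj, hj, .refl⟩)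
          · exact .inr (.inl ⟨hi, hj, hzj⟩)
        · have hza := haa hxz hx
          by_cases hj : j ∈ a
          · exact .inl (.inr ⟨x, ⟨hi, hx, hix⟩, hx, hj, hxz.tail ⟨hzj, hj⟩⟩)
          · exact .inr (.inr ⟨z, ⟨x, ⟨hi, hx, hix⟩, hx, hza, hxz⟩, hza, hj, hzj⟩)

end Zer

end SummaryGraphs

namespace SummaryGraphs

namespace EdgeMatrices

open Relation Sum

/-! ### The split graph and its path relations -/

section Defs

variable {V : Type*}

/-- Every node `i` is split into a residual `inl i` and a variable `inr i`. Dashed lines join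
residuals, full lines join variables, and `i ← k` joins the residual of `i` to the variable `k`. -/
def splitAdj (G : EdgeMatrices V) : V ⊕ V → V ⊕ V → Prop
  | inl i, inl k => G.dash i k ≠ 0
  | inl i, inr k => G.dir i k ≠ 0
  | inr k, inl i => G.dir i k ≠ 0
  | inr i, inr k => G.full i k ≠ 0

variable [Fintype V] [LinearOrder V] (G : EdgeMatrices V) (c m : Finset V)

/-- The residuals that inner path vertices may run through. -/
def ResidualPass : V ⊕ V → Prop
  | inl i => i ∈ G.rSet c
  | inr _ => False

/-- The variables that inner path vertices may run through. -/
def VariablePass : V ⊕ V → Prop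
  | inl _ => False
  | inr k => k ∈ G.lSet c m

/-- The split vertices that inner path vertices may run through. -/
def Pass (x : V ⊕ V) : Prop := G.ResidualPass c x ∨ G.VariablePass c m x

/-- Paths through the ancestors of the conditioning set and their marginalised parents. -/
def Core : V ⊕ V → V ⊕ V → Prop := Thru (G.Pass c m) G.splitAdj

/-- Directed paths through `h`, with the last node in `h` as well. -/
def Chain : V → V → Prop := ReflTransGen fun i x => G.dir i x ≠ 0 ∧ x ∈ G.hSet c m

/-- `Chain` on residuals, equality on variables. -/
def Lift : V ⊕ V → V ⊕ V → Prop
  | inl i, inl x => G.Chain c m i x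
  | inr k, inr y => k = y
  | _, _ => False

/-- The relation that induces all edges of the reduced graph. -/
def Full (a b : V ⊕ V) : Prop :=
  ∃ a₀ b₀, G.Lift c m a a₀ ∧ G.Core c m a₀ b₀ ∧ G.Lift c m b b₀

end Defs

/-! ### The node sets of a reduction -/

section Sets

variable {V : Type*} [Fintype V] [LinearOrder V] {G : EdgeMatrices V} {c m : Finset V} {i j : V}

/-- Loops can be deleted from a path, and the empty path accounts for the conditioned nodes
themselves; this merges `c_μ` and its foster nodes into one reachability condition. -/
theorem mem_rSet : j ∈ G.rSet c ↔ j ∈ G.u ∧ ∃ t ∈ c ∩ G.u,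
    ReflTransGen (fun i k => i ∈ G.u ∧ k ∈ G.u ∧ G.dir i k ≠ 0) t j := by
  simp only [rSet, foster, Finset.mem_union, Finset.mem_filter]
  constructor
  · rintro (h | ⟨hj, -, t, ht, h⟩)
    · exact ⟨(Finset.mem_inter.1 h).2, j, h, .refl⟩
    · exact ⟨hj, t, ht, ReflTransGen.mono (fun p q h => ⟨h.1, h.2.1, h.2.2.2⟩) _ _
        (TransGen.to_reflTransGen h)⟩
  · rintro ⟨hj, t, ht, h⟩
    by_cases hjc : j ∈ c ∩ G.u
    · exact .inl hjc
    refine .inr ⟨hj, hjc, t, ht, ?_⟩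
    have : t = j ∨ IsAncestor G.dir G.u t j := by
      clear hj hjc
      induction h with
      | refl => exact .inl rfl
      | @tail b d _ hbd ih =>
        by_cases h : b = d
        · exact h ▸ ih
        · have hs : b ∈ G.u ∧ d ∈ G.u ∧ b ≠ d ∧ G.dir b d ≠ 0 := ⟨hbd.1, hbd.2.1, h, hbd.2.2⟩
          rcases ih with rfl | ih
          exacts [.inr (.single hs), .inr (ih.tail hs)]
    rcases this with rfl | h
    exacts [absurd ht hjc, h]

theorem rSet_subset (h : j ∈ G.rSet c) : j ∈ G.u := (mem_rSet.1 h).1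

theorem rSet_of_mem (h : j ∈ c) (hu : j ∈ G.u) : j ∈ G.rSet c :=
  mem_rSet.2 ⟨hu, j, Finset.mem_inter.2 ⟨h, hu⟩, .refl⟩

theorem rSet_of_dir (h : i ∈ G.rSet c) (hj : j ∈ G.u) (hij : G.dir i j ≠ 0) : j ∈ G.rSet c := by
  obtain ⟨hi, t, ht, hti⟩ := mem_rSet.1 h
  exact mem_rSet.2 ⟨hj, t, ht, hti.tail ⟨hi, hj, hij⟩⟩

theorem mem_oSet : i ∈ G.oSet c ↔ i ∈ G.u ∧ i ∉ G.rSet c := by simp [oSet]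

theorem mem_psiSet : i ∈ G.psiSet c ↔ i ∈ G.rSet c ∨ i ∈ G.v := by simp [psiSet]

theorem mem_phiSet : i ∈ G.phiSet c ↔ (i ∈ G.rSet c ∨ i ∈ G.v) ∧ i ∉ c := by
  simp [phiSet, mem_psiSet]

theorem mem_hSet : i ∈ G.hSet c m ↔ (i ∈ G.u ∧ i ∉ G.rSet c) ∧ i ∈ m := by simp [hSet, mem_oSet]

theorem mem_lSet : i ∈ G.lSet c m ↔ ((i ∈ G.rSet c ∨ i ∈ G.v) ∧ i ∉ c) ∧ i ∈ m := by
  simp [lSet, mem_phiSet]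

theorem mem_uSet : i ∈ G.uSet c m ↔ (i ∈ G.u ∧ i ∉ G.rSet c) ∧ i ∉ m := by
  simp only [uSet, Finset.mem_sdiff, mem_oSet, mem_hSet]; tauto

theorem mem_vSet : i ∈ G.vSet c m ↔ ((i ∈ G.rSet c ∨ i ∈ G.v) ∧ i ∉ c) ∧ i ∉ m := by
  simp only [vSet, Finset.mem_sdiff, mem_phiSet, mem_lSet]; tauto

end Sets

/-! ### The matrices `Q`, `C`, `S`, `Z` and `K` as path relations -/

section Support

variable {V : Type*} [Fintype V] [LinearOrder V] {G : EdgeMatrices V} {c m : Finset V}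
  {i j k x y : V} {a b d : V ⊕ V}

theorem full_inl_inl : G.Full c m (inl i) (inl j) ↔
    ∃ x y, G.Chain c m i x ∧ G.Core c m (inl x) (inl y) ∧ G.Chain c m j y := by
  constructor
  · rintro ⟨x | x, y | y, h1, h2, h3⟩
    exacts [⟨x, y, h1, h2, h3⟩, h3.elim, h1.elim, h1.elim]
  · rintro ⟨x, y, h⟩
    exact ⟨inl x, inl y, h⟩

theorem full_inl_inr : G.Full c m (inl i) (inr k) ↔
    ∃ x, G.Chain c m i x ∧ G.Core c m (inl x) (inr k) := by
  constructor
  · rintro ⟨x | x, y | y, h1, h2, h3⟩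
    exacts [h3.elim, ⟨x, h1, (show k = y from h3) ▸ h2⟩, h1.elim, h1.elim]
  · rintro ⟨x, h1, h2⟩
    exact ⟨inl x, inr k, h1, h2, rfl⟩

theorem full_inr_inr : G.Full c m (inr i) (inr k) ↔ G.Core c m (inr i) (inr k) := by
  constructor
  · rintro ⟨x | x, y | y, h1, h2, h3⟩
    exacts [h1.elim, h1.elim, h3.elim, (show i = x from h1) ▸ (show k = y from h3) ▸ h2]
  · intro h
    exact ⟨inr i, inr k, rfl, h, rfl⟩

variable (hG : IsSummaryGraph G)
include hG

theorem splitAdj_symm (h : G.splitAdj a b) : G.splitAdj b a := by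
  rcases a with i | i <;> rcases b with k | k
  · exact fun h' => h ((hG.dash_symm _ _).trans h')
  · exact h
  · exact h
  · exact fun h' => h ((hG.full_symm _ _).trans h')

theorem core_symm (h : G.Core c m a b) : G.Core c m b a :=
  Thru.symm (fun _ _ => splitAdj_symm hG) h

theorem Full_symm (h : G.Full c m a b) : G.Full c m b a := by
  obtain ⟨a₀, b₀, h1, h2, h3⟩ := h
  exact ⟨b₀, a₀, h3, core_symm hG h2, h1⟩

theorem Q_ne_zero : G.Q c i j ≠ 0 ↔ Thru (· ∈ G.rSet c) (fun p q => G.dash p q ≠ 0) i j := by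
  have := nonnegEntries_of_binary hG.dash_binary
  rw [Q, zer_ne_zero (binary_le_one hG.dash_binary)]
  constructor
  · rintro (⟨rfl, h⟩ | h)
    · refine .single ?_
      rw [hG.dash_diag i (rSet_subset h)]
      exact one_ne_zero
    · exact h
  · exact .inr

theorem Q_self (h : i ∈ G.u) : G.Q c i i ≠ 0 :=
  (Q_ne_zero hG).2 (.single (by rw [hG.dash_diag i h]; exact one_ne_zero))

omit hG in
/-- Paths run first through residuals, then through variables. -/
theorem core_iff : G.Core c m a b ↔
    Thru (G.VariablePass c m) (Thru (G.ResidualPass c) G.splitAdj) a b := thru_or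

/-- No variable may be an inner vertex here, so the path stays among residuals, as a path counted by
`Q`, with at most a final arrow to a variable. -/
theorem thru_residual_inl : Thru (G.ResidualPass c) G.splitAdj (inl i) b ↔
    Sum.elim (fun j => G.Q c i j ≠ 0)
      (fun k => G.dir i k ≠ 0 ∨ ∃ x ∈ G.rSet c, G.Q c i x ≠ 0 ∧ G.dir x k ≠ 0) b := by
  constructor
  · intro h
    refine h.induction ?_ ?_
    · rintro (j | k) h
      exacts [(Q_ne_zero hG).2 (.single h), .inl h]
    · rintro (x | x) (j | k) h hx hxy
      · exact (Q_ne_zero hG).2 (((Q_ne_zero hG).1 h).tail hx hxy)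
      · exact .inr ⟨x, hx, h, hxy⟩
      · exact hx.elim
      · exact hx.elim
  · have hQ : ∀ j, G.Q c i j ≠ 0 → Thru (G.ResidualPass c) G.splitAdj (inl i) (inl j) := by
      intro j h
      exact ((Q_ne_zero hG).1 h).induction
        (P := fun j => Thru (G.ResidualPass c) G.splitAdj (inl i) (inl j))
        (fun x hx => .single hx) fun x y h hx hxy => h.tail hx hxy
    rcases b with j | k
    · exact hQ j
    · rintro (h | ⟨x, hx, h1, h2⟩)
      exacts [.single h, (hQ x h1).tail hx h2]

theorem thru_residual_inr_inr : Thru (G.ResidualPass c) G.splitAdj (inr i) (inr k) ↔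
    G.full i k ≠ 0 ∨ ∃ x ∈ G.rSet c, ∃ y ∈ G.rSet c,
      G.dir x i ≠ 0 ∧ G.Q c x y ≠ 0 ∧ G.dir y k ≠ 0 := by
  rw [thru_iff_head]
  refine or_congr Iff.rfl ⟨?_, ?_⟩
  · rintro ⟨x | x, h1, h2, h3⟩
    · rcases (thru_residual_inl hG).1 h3 with h3 | ⟨y, hy, h3, h4⟩
      -- A path that leaves the residual `x` at once uses the diagonal entry of `Q` as its middle
      -- factor.
      exacts [⟨x, h2, x, h2, h1, Q_self hG (rSet_subset h2), h3⟩, ⟨x, h2, y, hy, h1, h3, h4⟩]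
    · exact h2.elim
  · rintro ⟨x, hx, y, hy, h1, h2, h3⟩
    exact ⟨inl x, h1, hx, (thru_residual_inl hG).2 (.inr ⟨y, hy, h2, h3⟩)⟩

theorem Cmat_ne_zero : G.Cmat c i k ≠ 0 ↔ i ∈ G.oSet c ∧ k ∈ G.psiSet c ∧
    Thru (G.ResidualPass c) G.splitAdj (inl i) (inr k) := by
  have := nonnegEntries_of_binary hG.dir_binary
  have : NonnegEntries (G.Q c) := by unfold Q; infer_instance
  simp only [Cmat, ind_ne_zero, add_ne_zero, mul_ne_zero, blk_ne_zero, thru_residual_inl hG,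
    Sum.elim_inr]
  grind

theorem Spsi_ne_zero (hi : i ∈ G.psiSet c) (hk : k ∈ G.psiSet c) : G.Spsi c i k ≠ 0 ↔
    Thru (G.ResidualPass c) G.splitAdj (inr i) (inr k) := by
  have := nonnegEntries_of_binary hG.dir_binary
  have := nonnegEntries_of_binary hG.full_binary
  have : NonnegEntries (G.Q c) := by unfold Q; infer_instance
  simp only [Spsi, ind_ne_zero, add_ne_zero, mul_ne_zero, blk_ne_zero, transpose_ne_zero,
    thru_residual_inr_inr hG]
  grind

omit hG in
theorem core_inr_inr : G.Core c m (inr i) (inr k) ↔ Thru (· ∈ G.lSet c m)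
    (fun p q => Thru (G.ResidualPass c) G.splitAdj (inr p) (inr q)) i k := by
  rw [core_iff]
  constructor
  · intro h
    refine h.induction (P := Sum.elim (fun _ => True) fun k => Thru (· ∈ G.lSet c m)
      (fun p q => Thru (G.ResidualPass c) G.splitAdj (inr p) (inr q)) i k) ?_ ?_
    · rintro (k | k) h
      exacts [trivial, .single h]
    · rintro (x | x) (k | k) h hx hxy
      exacts [trivial, hx.elim, trivial, h.tail hx hxy]
  · intro h
    exact h.induction (P := fun k => Thru _ _ (inr i) (inr k)) (fun x hx => .single hx)
      fun x y h hx hxy => h.tail hx hxy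

/-- For a node of `r` the closed walk goes through its own residual. This reflexivity absorbs the
diagonal term of the partial closure. -/
theorem core_inr_self (h : i ∈ G.psiSet c) : G.Core c m (inr i) (inr i) := by
  refine (core_inr_inr).2 (.single ((thru_residual_inr_inr hG).2 ?_))
  rcases mem_psiSet.1 h with h | h
  · have : G.dir i i ≠ 0 := by rw [hG.dir_diag i (rSet_subset h)]; exact one_ne_zero
    exact .inr ⟨i, h, i, h, this, Q_self hG (rSet_subset h), this⟩
  · left; rw [hG.full_diag i h]; exact one_ne_zero

omit hG in
theorem lSet_subset_phiSet (h : i ∈ G.lSet c m) : i ∈ G.phiSet c := (Finset.mem_inter.1 h).1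

omit hG in
theorem phiSet_subset_psiSet (h : i ∈ G.phiSet c) : i ∈ G.psiSet c := (Finset.mem_sdiff.1 h).1

/-- Inner variables lie in `l`, hence in `φ`, so restricting the matrix to the `φφ`-block loses no
path between nodes of `φ`. -/
theorem core_inr_inr_blk (hi : i ∈ G.phiSet c) (hk : k ∈ G.phiSet c) :
    G.Core c m (inr i) (inr k) ↔ Thru (· ∈ G.lSet c m)
      (fun p q => blk (G.phiSet c) (G.phiSet c) (G.Spsi c) p q ≠ 0) i k := by
  rw [core_inr_inr]
  have key : ∀ p q, p ∈ G.phiSet c → q ∈ G.phiSet c →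
      (blk (G.phiSet c) (G.phiSet c) (G.Spsi c) p q ≠ 0 ↔
        Thru (G.ResidualPass c) G.splitAdj (inr p) (inr q)) := by
    intro p q hp hq
    rw [blk_ne_zero, Spsi_ne_zero hG (phiSet_subset_psiSet hp) (phiSet_subset_psiSet hq)]
    simp [hp, hq]
  constructor
  · intro h
    refine h.induction (P := fun k => k ∈ G.phiSet c → Thru (· ∈ G.lSet c m)
      (fun p q => blk (G.phiSet c) (G.phiSet c) (G.Spsi c) p q ≠ 0) i k) ?_ ?_ hk
    · exact fun x hx h => .single ((key _ _ hi h).2 hx)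
    · exact fun x y h hx hxy hy => (h (lSet_subset_phiSet hx)).tail hx
        ((key _ _ (lSet_subset_phiSet hx) hy).2 hxy)
  · exact fun h => h.mono (fun _ => id) fun p q h =>
      (key p q (blk_ne_zero.1 h).1 (blk_ne_zero.1 h).2.1).1 h

theorem Z_ne_zero (hi : i ∈ G.phiSet c) (hk : k ∈ G.phiSet c) :
    G.Z c m i k ≠ 0 ↔ G.Core c m (inr i) (inr k) := by
  have h1 : ∀ i j, blk (G.phiSet c) (G.phiSet c) (G.Spsi c) i j = 0 ∨
    blk (G.phiSet c) (G.phiSet c) (G.Spsi c) i j = 1 := fun i j => blk_binary (ind_binary _ i j)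
  have := nonnegEntries_of_binary h1
  rw [Z, zer_ne_zero (binary_le_one h1), ← core_inr_inr_blk hG hi hk]
  constructor
  · rintro (⟨rfl, -⟩ | h)
    exacts [core_inr_self hG (phiSet_subset_psiSet hi), h]
  · exact .inr

omit hG in
theorem core_inl_inr : G.Core c m (inl x) (inr k) ↔
    Thru (G.ResidualPass c) G.splitAdj (inl x) (inr k) ∨ ∃ y ∈ G.lSet c m,
      Thru (G.ResidualPass c) G.splitAdj (inl x) (inr y) ∧ G.Core c m (inr y) (inr k) := by
  rw [core_iff, thru_iff_head]
  refine or_congr Iff.rfl ⟨?_, ?_⟩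
  · rintro ⟨y | y, h1, h2, h3⟩
    exacts [h2.elim, ⟨y, h2, h1, core_iff.2 h3⟩]
  · rintro ⟨y, h1, h2, h3⟩
    exact ⟨inr y, h2, h1, core_iff.1 h3⟩

/-- The path is cut at a variable of `l`. That variable serves as both `p` and `q`, with a closed
walk between them, to match the product in which `S_ll` stands in the middle. -/
theorem core_inl_inl : G.Core c m (inl x) (inl y) ↔ G.Q c x y ≠ 0 ∨
    ∃ p ∈ G.lSet c m, ∃ q ∈ G.lSet c m, G.Core c m (inl x) (inr p) ∧
      G.Core c m (inr p) (inr q) ∧ G.Core c m (inl y) (inr q) := by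
  constructor
  · rw [core_iff, thru_iff_tail]
    rintro (h | ⟨p | p, h1, h2, h3⟩)
    · exact .inl ((thru_residual_inl hG).1 h)
    · exact h2.elim
    · refine .inr ⟨p, h2, p, h2, core_iff.2 h1,
        core_inr_self hG (phiSet_subset_psiSet (lSet_subset_phiSet h2)), ?_⟩
      exact core_iff.2 (.single (Thru.symm (fun _ _ => splitAdj_symm hG) h3))
  · rintro (h | ⟨p, hp, q, hq, h1, h2, h3⟩)
    · exact core_iff.2 (.single ((thru_residual_inl hG).2 h))
    · exact (Thru.trans h1 (.inr hp) h2).trans (.inr hq) (core_symm hG h3)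

omit hG in
theorem chain_mem_oSet (hi : i ∈ G.oSet c) (h : G.Chain c m i x) : x ∈ G.oSet c := by
  rcases ReflTransGen.cases_tail h with rfl | ⟨_, -, -, h⟩
  exacts [hi, (Finset.mem_inter.1 h).1]

theorem oSet_not_mem_phiSet (hi : i ∈ G.oSet c) : i ∉ G.phiSet c := by
  intro h
  obtain ⟨h1, h2⟩ := mem_oSet.1 hi
  rcases (mem_phiSet.1 h).1 with h | h
  exacts [h2 h, Finset.disjoint_left.1 hG.disjoint h1 h]

/-- Block triangularity prevents a path that has entered `φ` from returning to `o`. It is therefore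
a chain through `h`, followed by either one more arrow within `o`, or a `C`-step and then steps of
`S` through `l`. -/
theorem K_ne_zero (hi : i ∈ G.uSet c m) : G.K c m i k ≠ 0 ↔
    (k ∈ G.oSet c ∧ ∃ x, G.Chain c m i x ∧ G.dir x k ≠ 0) ∨
      (k ∈ G.phiSet c ∧ G.Full c m (inl i) (inr k)) := by
  have hio : i ∈ G.oSet c := (Finset.mem_sdiff.1 hi).1
  have hihl : i ∉ G.hSet c m ∪ G.lSet c m := by
    rw [Finset.mem_union, not_or]
    exact ⟨(Finset.mem_sdiff.1 hi).2, fun h =>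
      oSet_not_mem_phiSet hG hio (lSet_subset_phiSet h)⟩
  set M := blk (G.oSet c) (G.oSet c) G.dir + blk (G.oSet c) (G.phiSet c) (G.Cmat c)
      + blk (G.phiSet c) (G.phiSet c) (G.Spsi c) with hM
  have := nonnegEntries_of_binary hG.dir_binary
  have hC : NonnegEntries (G.Cmat c) := by unfold Cmat; infer_instance
  have hS : NonnegEntries (G.Spsi c) := by unfold Spsi; infer_instance
  have hMn : NonnegEntries M := inferInstance
  have hM1 : ∀ p q, M p q ≤ 1 := by
    intro p q
    have h1 := binary_le_one hG.dir_binary p q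
    have h2 : G.Cmat c p q ≤ 1 := binary_le_one (ind_binary _) p q
    have h3 : G.Spsi c p q ≤ 1 := binary_le_one (ind_binary _) p q
    have h4 : p ∈ G.oSet c → p ∉ G.phiSet c := oSet_not_mem_phiSet hG
    -- The three summands have disjoint supports, so their sum keeps entries at most one, as the
    -- closure criterion requires.
    have h5 : q ∈ G.oSet c → q ∉ G.phiSet c := oSet_not_mem_phiSet hG
    simp only [hM, Matrix.add_apply, blk]
    split_ifs <;> first | linarith | tauto
  have hMs : ∀ p q, M p q ≠ 0 ↔ (p ∈ G.oSet c ∧ q ∈ G.oSet c ∧ G.dir p q ≠ 0) ∨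
      (p ∈ G.oSet c ∧ q ∈ G.phiSet c ∧
        Thru (G.ResidualPass c) G.splitAdj (inl p) (inr q)) ∨
      blk (G.phiSet c) (G.phiSet c) (G.Spsi c) p q ≠ 0 := by
    intro p q
    simp only [hM, add_ne_zero, blk_ne_zero, Cmat_ne_zero hG]
    have := @phiSet_subset_psiSet _ _ _ G c q
    tauto
  have hK : G.K c m = zer (G.hSet c m ∪ G.lSet c m) M := rfl
  rw [hK, zer_ne_zero hM1, full_inl_inr]
  constructor
  · rintro (⟨-, h⟩ | h)
    · exact absurd h hihl
    refine h.induction (P := fun k => (k ∈ G.oSet c ∧ ∃ x, G.Chain c m i x ∧ G.dir x k ≠ 0) ∨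
      (k ∈ G.phiSet c ∧ ∃ x, G.Chain c m i x ∧ G.Core c m (inl x) (inr k))) ?_ ?_
    · intro k hk
      rcases (hMs _ _).1 hk with ⟨-, h1, h2⟩ | ⟨-, h1, h2⟩ | h
      · exact .inl ⟨h1, i, .refl, h2⟩
      · exact .inr ⟨h1, i, .refl, core_iff.2 (.single h2)⟩
      · exact absurd (blk_ne_zero.1 h).1 (oSet_not_mem_phiSet hG hio)
    · intro y k ih hy hyk
      rcases (hMs _ _).1 hyk with ⟨h0, h1, h2⟩ | ⟨h0, h1, h2⟩ | h
      · rcases ih with ⟨-, x, hx, hxy⟩ | ⟨h, -⟩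
        · have hyh : y ∈ G.hSet c m := (Finset.mem_union.1 hy).resolve_right
            fun h => oSet_not_mem_phiSet hG h0 (lSet_subset_phiSet h)
          exact .inl ⟨h1, y, hx.tail ⟨hxy, hyh⟩, h2⟩
        · exact absurd h (oSet_not_mem_phiSet hG h0)
      · rcases ih with ⟨-, x, hx, hxy⟩ | ⟨h, -⟩
        · have hyh : y ∈ G.hSet c m := (Finset.mem_union.1 hy).resolve_right
            fun h => oSet_not_mem_phiSet hG h0 (lSet_subset_phiSet h)
          exact .inr ⟨h1, y, hx.tail ⟨hxy, hyh⟩, core_iff.2 (.single h2)⟩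
        · exact absurd h (oSet_not_mem_phiSet hG h0)
      · obtain ⟨h0, h1, h2⟩ := blk_ne_zero.1 h
        rcases ih with ⟨h, -⟩ | ⟨-, x, hx, hxy⟩
        · exact absurd h0 (oSet_not_mem_phiSet hG h)
        · have hyl : y ∈ G.lSet c m := (Finset.mem_union.1 hy).resolve_left
            fun h => oSet_not_mem_phiSet hG (Finset.mem_inter.1 h).1 h0
          exact .inr ⟨h1, x, hx, Thru.trans hxy (.inr hyl)
            ((core_inr_inr_blk hG h0 h1).2 (.single h))⟩
  · have hchain : ∀ x, G.Chain c m i x →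
        ReflTransGen (fun p q => M p q ≠ 0 ∧ q ∈ G.hSet c m ∪ G.lSet c m) i x := by
      intro x hx
      induction hx with
      | refl => exact .refl
      | tail hb hbd ih =>
        exact ih.tail ⟨(hMs _ _).2 (.inl ⟨chain_mem_oSet hio hb,
          (Finset.mem_inter.1 hbd.2).1, hbd.1⟩), Finset.mem_union_left _ hbd.2⟩
    rintro (⟨hk, x, hx, hxk⟩ | ⟨hk, x, hx, hxk⟩)
    · exact .inr ⟨x, hchain x hx, (hMs _ _).2 (.inl ⟨chain_mem_oSet hio hx, hk, hxk⟩)⟩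
    · have hxo := chain_mem_oSet hio hx
      rcases (core_inl_inr).1 hxk with h | ⟨y, hy, h1, h2⟩
      · exact .inr ⟨x, hchain x hx, (hMs _ _).2 (.inr (.inl ⟨hxo, hk, h⟩))⟩
      · have hyp := lSet_subset_phiSet hy
        right
        refine Thru.trans (j := y) ?_ (Finset.mem_union_right _ hy) <|
          ((core_inr_inr_blk hG hyp hk).1 h2).mono (fun _ => Finset.mem_union_right _)
            fun p q h => (hMs p q).2 (.inr (.inr h))
        exact ⟨x, hchain x hx, (hMs _ _).2 (.inr (.inl ⟨hxo, hyp, h1⟩))⟩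

end Support

/-! ### The reduction as a restricted path relation -/

section Reduce

variable {V : Type*} [Fintype V] [LinearOrder V] {G : EdgeMatrices V} {c m : Finset V}
  {i j k x y : V} {a b d : V ⊕ V}

/-- The split vertices of the reduced graph. -/
def IsVertex (G : EdgeMatrices V) (c m : Finset V) : V ⊕ V → Prop
  | inl i => i ∈ G.uSet c m
  | inr k => k ∈ G.uSet c m ∨ k ∈ G.vSet c m

variable (hG : IsSummaryGraph G)
include hG

theorem dir_self (h : i ∈ G.u) : G.dir i i ≠ 0 := by
  rw [hG.dir_diag i h]; exact one_ne_zero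

theorem dash_self (h : i ∈ G.u) : G.dash i i ≠ 0 := by
  rw [hG.dash_diag i h]; exact one_ne_zero

/-- A path to a variable outside `r ∪ v` ends with its only possible arrow. -/
theorem core_inr_of_mem_oSet (hk : k ∈ G.oSet c) (h : G.Core c m a (inr k)) :
    ∃ x, a = inl x ∧ G.dir x k ≠ 0 := by
  obtain ⟨hku, hkr⟩ := mem_oSet.1 hk
  have hfull : ∀ j, ¬ G.splitAdj (inr j) (inr k) := fun j h =>
    Finset.disjoint_left.1 hG.disjoint hku (hG.full_supp _ _ h).2
  rcases thru_iff_tail.1 h with h | ⟨w | w, -, hw, h⟩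
  · rcases a with x | x
    exacts [⟨x, rfl, h⟩, absurd h (hfull x)]
  · rcases hw with hw | hw
    exacts [absurd (rSet_of_dir hw hku h) hkr, hw.elim]
  · exact absurd h (hfull w)

theorem full_inr_of_mem_oSet (hk : k ∈ G.oSet c) (h : G.Full c m a (inr k)) :
    ∃ i x, a = inl i ∧ G.Chain c m i x ∧ G.dir x k ≠ 0 := by
  rcases a with i | i
  · obtain ⟨x, hx, h⟩ := full_inl_inr.1 h
    obtain ⟨_, h0, h⟩ := core_inr_of_mem_oSet hG hk h
    cases h0
    exact ⟨i, x, rfl, hx, h⟩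
  · obtain ⟨_, h, -⟩ := core_inr_of_mem_oSet hG hk (full_inr_inr.1 h)
    cases h

theorem full_inl_inr_of_mem_oSet (hk : k ∈ G.oSet c) :
    G.Full c m (inl i) (inr k) ↔ ∃ x, G.Chain c m i x ∧ G.dir x k ≠ 0 := by
  constructor
  · intro h
    obtain ⟨_, x, h0, h⟩ := full_inr_of_mem_oSet hG hk h
    cases h0
    exact ⟨x, h⟩
  · rintro ⟨x, h1, h2⟩
    exact full_inl_inr.2 ⟨x, h1, .single h2⟩

theorem K_ne_zero_iff_full (hi : i ∈ G.uSet c m) (hk : k ∈ G.oSet c ∨ k ∈ G.phiSet c) :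
    G.K c m i k ≠ 0 ↔ G.Full c m (inl i) (inr k) := by
  rw [K_ne_zero hG hi]
  rcases hk with h | h
  · have := oSet_not_mem_phiSet hG h
    simp only [full_inl_inr_of_mem_oSet hG h, h, this, true_and, false_and, or_false]
  · have : k ∉ G.oSet c := fun h' => oSet_not_mem_phiSet hG h' h
    tauto

omit hG in
theorem uSet_subset_oSet (h : i ∈ G.uSet c m) : i ∈ G.oSet c := (Finset.mem_sdiff.1 h).1

omit hG in
theorem vSet_subset_phiSet (h : i ∈ G.vSet c m) : i ∈ G.phiSet c := (Finset.mem_sdiff.1 h).1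

omit hG in
theorem uSet_subset_u (h : i ∈ G.uSet c m) : i ∈ G.u := (mem_uSet.1 h).1.1

theorem uSet_not_mem_vSet (h : i ∈ G.uSet c m) : i ∉ G.vSet c m := fun h' =>
  oSet_not_mem_phiSet hG (uSet_subset_oSet h) (vSet_subset_phiSet h')

theorem reduce_dir_ne_zero : (G.reduce c m).dir i k ≠ 0 ↔
    i ∈ G.uSet c m ∧ (k ∈ G.uSet c m ∨ k ∈ G.vSet c m) ∧ G.Full c m (inl i) (inr k) := by
  have : NonnegEntries (G.K c m) := by unfold K; infer_instance
  have h1 : (G.reduce c m).dir = blk (G.uSet c m) (G.uSet c m) (G.K c m) +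
    blk (G.uSet c m) (G.vSet c m) (G.K c m) := rfl
  rw [h1, add_ne_zero, blk_ne_zero, blk_ne_zero, ← and_or_left, ← or_and_right]
  refine and_congr_right fun hi => and_congr_right fun hk => K_ne_zero_iff_full hG hi ?_
  exact hk.imp uSet_subset_oSet vSet_subset_phiSet

theorem reduce_full_ne_zero : (G.reduce c m).full i k ≠ 0 ↔
    i ∈ G.vSet c m ∧ k ∈ G.vSet c m ∧ G.Full c m (inr i) (inr k) := by
  have h1 : (G.reduce c m).full = blk (G.vSet c m) (G.vSet c m) (G.Z c m) := rfl
  rw [h1, blk_ne_zero, full_inr_inr]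
  exact and_congr_right fun hi => and_congr_right fun hk =>
    Z_ne_zero hG (vSet_subset_phiSet hi) (vSet_subset_phiSet hk)

/-- A nontrivial chain is an entry of `K_uh`. Allowing the trivial chain on either side produces the
four `Q`-terms in the formula for the dashed lines. -/
theorem chain_iff_of_mem_uSet (hi : i ∈ G.uSet c m) : G.Chain c m i x ↔
    x = i ∨ x ∈ G.hSet c m ∧ G.K c m i x ≠ 0 := by
  constructor
  · intro h
    rcases ReflTransGen.cases_tail h with rfl | ⟨w, h1, h2, h3⟩
    · exact .inl rfl
    · have hx := (Finset.mem_inter.1 h3).1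
      refine .inr ⟨h3, (K_ne_zero_iff_full hG hi (.inl hx)).2 ?_⟩
      exact (full_inl_inr_of_mem_oSet hG hx).2 ⟨w, h1, h2⟩
  · rintro (rfl | ⟨h1, h2⟩)
    · exact .refl
    · have hx := (Finset.mem_inter.1 h1).1
      obtain ⟨w, h3, h4⟩ := (full_inl_inr_of_mem_oSet hG hx).1
        ((K_ne_zero_iff_full hG hi (.inl hx)).1 h2)
      exact h3.tail ⟨h4, h1⟩

theorem full_inl_inl_iff (hi : i ∈ G.uSet c m) (hj : j ∈ G.uSet c m) :
    G.Full c m (inl i) (inl j) ↔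
    (∃ x y, G.Chain c m i x ∧ G.Q c x y ≠ 0 ∧ G.Chain c m j y) ∨
    ∃ p ∈ G.lSet c m, ∃ q ∈ G.lSet c m, G.K c m i p ≠ 0 ∧ G.Z c m p q ≠ 0 ∧ G.K c m j q ≠ 0 := by
  rw [full_inl_inl]
  constructor
  · rintro ⟨x, y, hx, h, hy⟩
    rcases (core_inl_inl hG).1 h with h | ⟨p, hp, q, hq, h1, h2, h3⟩
    · exact .inl ⟨x, y, hx, h, hy⟩
    · have hp' := lSet_subset_phiSet hp
      have hq' := lSet_subset_phiSet hq
      refine .inr ⟨p, hp, q, hq, ?_, (Z_ne_zero hG hp' hq').2 h2, ?_⟩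
      · exact (K_ne_zero_iff_full hG hi (.inr hp')).2 (full_inl_inr.2 ⟨x, hx, h1⟩)
      · exact (K_ne_zero_iff_full hG hj (.inr hq')).2 (full_inl_inr.2 ⟨y, hy, h3⟩)
  · rintro (⟨x, y, hx, h, hy⟩ | ⟨p, hp, q, hq, h1, h2, h3⟩)
    · exact ⟨x, y, hx, (core_inl_inl hG).2 (.inl h), hy⟩
    · have hp' := lSet_subset_phiSet hp
      have hq' := lSet_subset_phiSet hq
      rw [K_ne_zero_iff_full hG hi (.inr hp'), full_inl_inr] at h1
      rw [K_ne_zero_iff_full hG hj (.inr hq'), full_inl_inr] at h3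
      obtain ⟨x, hx, h1⟩ := h1
      obtain ⟨y, hy, h3⟩ := h3
      exact ⟨x, y, hx, (core_inl_inl hG).2
        (.inr ⟨p, hp, q, hq, h1, (Z_ne_zero hG hp' hq').1 h2, h3⟩), hy⟩

theorem reduce_dash_ne_zero : (G.reduce c m).dash i j ≠ 0 ↔
    i ∈ G.uSet c m ∧ j ∈ G.uSet c m ∧ G.Full c m (inl i) (inl j) := by
  have : NonnegEntries (G.K c m) := by unfold K; infer_instance
  have : NonnegEntries (G.Q c) := by unfold Q; infer_instance
  have : NonnegEntries (G.Z c m) := by unfold Z; infer_instance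
  simp only [reduce, ind_ne_zero, add_ne_zero, mul_ne_zero, blk_ne_zero, transpose_ne_zero]
  constructor
  · intro h
    have hij : i ∈ G.uSet c m ∧ j ∈ G.uSet c m := by grind
    refine ⟨hij.1, hij.2, (full_inl_inl_iff hG hij.1 hij.2).2 ?_⟩
    simp only [chain_iff_of_mem_uSet hG hij.1, chain_iff_of_mem_uSet hG hij.2]
    rcases h with (((⟨-, -, h⟩ | ⟨x, ⟨-, hx, h1⟩, -, -, h2⟩) | ⟨x, ⟨-, hx, h1⟩, -, -, h2⟩) |
      ⟨x, ⟨y, ⟨-, hy, h1⟩, -, hx, h2⟩, -, -, h3⟩) | ⟨x, ⟨y, ⟨-, hy, h1⟩, -, hx, h2⟩, -, -, h3⟩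
    · exact .inl ⟨i, j, .inl rfl, h, .inl rfl⟩
    · exact .inl ⟨x, j, .inr ⟨hx, h1⟩, h2, .inl rfl⟩
    · exact .inl ⟨i, x, .inl rfl, h1, .inr ⟨hx, h2⟩⟩
    · exact .inl ⟨y, x, .inr ⟨hy, h1⟩, h2, .inr ⟨hx, h3⟩⟩
    · exact .inr ⟨y, hy, x, hx, h1, h2, h3⟩
  · rintro ⟨hi, hj, h⟩
    rw [full_inl_inl_iff hG hi hj] at h
    simp only [chain_iff_of_mem_uSet hG hi, chain_iff_of_mem_uSet hG hj] at h
    rcases h with ⟨x, y, rfl | ⟨hx, h1⟩, h, rfl | ⟨hy, h2⟩⟩ | ⟨p, hp, q, hq, h1, h2, h3⟩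
    · exact .inl (.inl (.inl (.inl ⟨hi, hj, h⟩)))
    · exact .inl (.inl (.inr ⟨y, ⟨hi, hy, h⟩, hj, hy, h2⟩))
    · exact .inl (.inl (.inl (.inr ⟨x, ⟨hi, hx, h1⟩, hx, hj, h⟩)))
    · exact .inl (.inr ⟨y, ⟨x, ⟨hi, hx, h1⟩, hx, hy, h⟩, hj, hy, h2⟩)
    · exact .inr ⟨q, ⟨p, ⟨hi, hp, h1⟩, hp, hq, h2⟩, hj, hq, h3⟩

/-- This single description of all three edge matrices is what makes iterated reductions comparable.
-/
theorem reduce_splitAdj : (G.reduce c m).splitAdj a b ↔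
    G.IsVertex c m a ∧ G.IsVertex c m b ∧ G.Full c m a b := by
  rcases a with i | i <;> rcases b with k | k
  · exact reduce_dash_ne_zero hG
  · exact reduce_dir_ne_zero hG
  · refine (reduce_dir_ne_zero hG).trans ?_
    have : G.Full c m (inl k) (inr i) ↔ G.Full c m (inr i) (inl k) :=
      ⟨Full_symm hG, Full_symm hG⟩
    simp only [IsVertex, this]; tauto
  · refine (reduce_full_ne_zero hG).trans ⟨fun h => ⟨.inr h.1, .inr h.2.1, h.2.2⟩, ?_⟩
    rintro ⟨hi, hk, h⟩
    -- A variable in `u` can only be entered by an arrow from a residual, so two variables related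
    -- by `Full` must both lie in `v`.
    have key : ∀ {i k}, G.Full c m (inr i) (inr k) → k ∉ G.uSet c m := by
      intro i k h hk
      obtain ⟨_, _, h, -⟩ := full_inr_of_mem_oSet hG (uSet_subset_oSet hk) h
      cases h
    exact ⟨hi.resolve_left (key (Full_symm hG h)), hk.resolve_left (key h), h⟩

theorem reduce_dir_binary (i k : V) : (G.reduce c m).dir i k = 0 ∨ (G.reduce c m).dir i k = 1 := by
  have h1 : (G.reduce c m).dir = blk (G.uSet c m) (G.uSet c m) (G.K c m) +
    blk (G.uSet c m) (G.vSet c m) (G.K c m) := rfl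
  have h2 := zer_binary (G.hSet c m ∪ G.lSet c m)
    (blk (G.oSet c) (G.oSet c) G.dir + blk (G.oSet c) (G.phiSet c) (G.Cmat c)
      + blk (G.phiSet c) (G.phiSet c) (G.Spsi c)) i k
  have h3 : k ∈ G.uSet c m → k ∉ G.vSet c m := uSet_not_mem_vSet hG
  rw [h1, Matrix.add_apply]
  unfold blk
  split_ifs <;> first | tauto | simpa [K] using h2

theorem isSummaryGraph_reduce : IsSummaryGraph (G.reduce c m) := by
  have hfb : ∀ i k, (G.reduce c m).full i k = 0 ∨ (G.reduce c m).full i k = 1 :=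
    fun i k => blk_binary (zer_binary _ _ i k)
  have hdb : ∀ i k, (G.reduce c m).dash i k = 0 ∨ (G.reduce c m).dash i k = 1 :=
    fun i k => ind_binary _ i k
  have hsymm : ∀ {X : Matrix V V ℝ}, (∀ i k, X i k = 0 ∨ X i k = 1) →
      (∀ i k, X i k ≠ 0 → X k i ≠ 0) → ∀ i k, X i k = X k i := by
    intro X h1 h2 i k
    have h3 := h2 i k
    have h4 := h2 k i
    rcases h1 i k with h | h <;> rcases h1 k i with h' | h' <;> simp_all
  refine
    { disjoint := Finset.disjoint_left.2 fun i => uSet_not_mem_vSet hG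
      dir_binary := reduce_dir_binary hG
      dash_binary := hdb
      full_binary := hfb
      dir_supp := fun i k h => ?_
      dash_supp := fun i k h => ?_
      full_supp := fun i k h => ?_
      dir_diag := fun i hi => ?_
      dash_diag := fun i hi => ?_
      full_diag := fun i hi => ?_
      dir_upper := fun i hi k hk hki => ?_
      dash_symm := hsymm hdb fun i k h => ?_
      full_symm := hsymm hfb fun i k h => ?_ }
  · rw [reduce_dir_ne_zero hG] at h
    exact ⟨h.1, Finset.mem_union.2 h.2.1⟩
  · rw [reduce_dash_ne_zero hG] at h
    exact ⟨h.1, h.2.1⟩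
  · rw [reduce_full_ne_zero hG] at h
    exact ⟨h.1, h.2.1⟩
  · refine (reduce_dir_binary hG i i).resolve_left ((reduce_dir_ne_zero hG).2 ⟨hi, .inl hi, ?_⟩)
    exact full_inl_inr.2 ⟨i, .refl, .single (dir_self hG (uSet_subset_u hi))⟩
  · refine (hdb i i).resolve_left ((reduce_dash_ne_zero hG).2 ⟨hi, hi, ?_⟩)
    exact full_inl_inl.2 ⟨i, i, .refl, .single (dash_self hG (uSet_subset_u hi)), .refl⟩
  · refine (hfb i i).resolve_left ((reduce_full_ne_zero hG).2 ⟨hi, hi, full_inr_inr.2 ?_⟩)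
    exact core_inr_self hG (phiSet_subset_psiSet (vSet_subset_phiSet hi))
  · by_contra h
    obtain ⟨-, -, h⟩ := (reduce_dir_ne_zero hG).1 h
    obtain ⟨x, hx, hxk⟩ := (full_inl_inr_of_mem_oSet hG (uSet_subset_oSet hk)).1 h
    -- Nodes weakly increase along a chain, which preserves upper triangularity.
    have hix : x ∈ G.u ∧ i ≤ x := by
      clear hxk
      induction hx with
      | refl => exact ⟨uSet_subset_u hi, le_rfl⟩
      | tail _ h ih =>
        have hd := (mem_hSet.1 h.2).1.1
        exact ⟨hd, ih.2.trans (not_lt.1 fun hlt => h.1 (hG.dir_upper _ ih.1 _ hd hlt))⟩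
    exact hxk (hG.dir_upper x hix.1 k (uSet_subset_u hk) (hki.trans_le hix.2))
  · rw [reduce_dash_ne_zero hG] at h ⊢
    exact ⟨h.2.1, h.1, Full_symm hG h.2.2⟩
  · rw [reduce_full_ne_zero hG] at h ⊢
    exact ⟨h.2.1, h.1, Full_symm hG h.2.2⟩

omit hG in
theorem nodes_reduce : (G.reduce c m).nodes = G.nodes \ (c ∪ m) := by
  ext i
  have h1 := @rSet_subset _ _ _ G c i
  have h2 := @rSet_of_mem _ _ _ G c i
  have : i ∈ (G.reduce c m).nodes ↔ i ∈ G.uSet c m ∨ i ∈ G.vSet c m := Finset.mem_union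
  rw [this, mem_uSet, mem_vSet, nodes, Finset.mem_sdiff, Finset.mem_union, Finset.mem_union]
  tauto

end Reduce

/-! ### Composing paths with chains -/

section Lift

variable {V : Type*} [Fintype V] [LinearOrder V] {G : EdgeMatrices V} {c m : Finset V}
  {i j k x y : V} {a b z : V ⊕ V}

theorem lift_self (a : V ⊕ V) : G.Lift c m a a := by
  rcases a with i | i
  exacts [ReflTransGen.refl, rfl]

theorem full_of_core (h : G.Core c m a b) : G.Full c m a b := ⟨a, b, lift_self a, h, lift_self b⟩

theorem rSet_of_reflTransGen (h : i ∈ G.rSet c)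
    (hij : ReflTransGen (fun i k => i ∈ G.u ∧ k ∈ G.u ∧ G.dir i k ≠ 0) i j) : j ∈ G.rSet c := by
  induction hij with
  | refl => exact h
  | tail _ hbd ih => exact rSet_of_dir ih hbd.2.1 hbd.2.2

theorem rSet_of_chain {c' : Finset V} (h : i ∈ G.rSet c') (hij : G.Chain c m i j) :
    j ∈ G.rSet c' := by
  induction hij with
  | refl => exact h
  | tail _ hbd ih => exact rSet_of_dir ih (mem_hSet.1 hbd.2).1.1 hbd.1

/-- Within `u`, `r` is closed under taking parents and is disjoint from `h`. -/
theorem chain_eq_of_mem_rSet (h : i ∈ G.rSet c) (hij : G.Chain c m i j) : i = j := by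
  rcases ReflTransGen.cases_tail hij with h' | ⟨_, -, -, hj⟩
  exacts [h'.symm, absurd (rSet_of_chain h hij) (mem_hSet.1 hj).1.2]

theorem lift_eq_of_pass (hz : G.Pass c m z) (h : G.Lift c m z a) : z = a := by
  rcases z with z | z <;> rcases a with a | a
  · rcases hz with hz | hz
    exacts [congrArg _ (chain_eq_of_mem_rSet hz h), hz.elim]
  · exact h.elim
  · exact h.elim
  · exact congrArg _ h

/-- A passable vertex has only the trivial lift, so the two core paths really meet at `z`. -/
theorem Full_trans (h : G.Full c m a z) (hz : G.Pass c m z) (h' : G.Full c m z b) :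
    G.Full c m a b := by
  obtain ⟨a₀, z₀, h1, h2, h3⟩ := h
  obtain ⟨z₁, b₀, h4, h5, h6⟩ := h'
  obtain rfl := lift_eq_of_pass hz h3
  obtain rfl := lift_eq_of_pass hz h4
  exact ⟨a₀, b₀, h1, Thru.trans h2 hz h5, h6⟩

theorem Full_tail (h : G.Full c m a z) (hz : G.Pass c m z) (h' : G.splitAdj z b) :
    G.Full c m a b := Full_trans h hz (full_of_core (.single h'))

theorem Full_lift_right (h : G.Full c m a b) (h' : G.Lift c m z b) : G.Full c m a z := by
  obtain ⟨a₀, b₀, h1, h2, h3⟩ := h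
  refine ⟨a₀, b₀, h1, h2, ?_⟩
  rcases z with z | z <;> rcases b with b | b <;> rcases b₀ with b₀ | b₀
  all_goals first | exact h'.elim | exact h3.elim | skip
  exacts [ReflTransGen.trans h' h3, Eq.trans h' h3]

theorem Full_lift_left (h : G.Full c m a b) (h' : G.Lift c m z a) : G.Full c m z b := by
  obtain ⟨a₀, b₀, h1, h2, h3⟩ := h
  refine ⟨a₀, b₀, ?_, h2, h3⟩
  rcases z with z | z <;> rcases a with a | a <;> rcases a₀ with a₀ | a₀
  all_goals first | exact h'.elim | exact h1.elim | skip
  exacts [ReflTransGen.trans h' h1, Eq.trans h' h1]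

end Lift

/-! ### Two successive reductions compared with the joint one -/

section TwoSteps

variable {V : Type*} [Fintype V] [LinearOrder V] {G : EdgeMatrices V} {c₁ m₁ c₂ m₂ : Finset V}
  {i j k x y : V} {a b z w : V ⊕ V}

theorem rSet_mono (h : i ∈ G.rSet c₁) : i ∈ G.rSet (c₁ ∪ c₂) := by
  obtain ⟨hi, t, ht, h⟩ := mem_rSet.1 h
  exact mem_rSet.2 ⟨hi, t, Finset.inter_subset_inter_right Finset.subset_union_left ht, h⟩

theorem dir_of_chain (hG : IsSummaryGraph G) (hx : x ∈ G.uSet c₁ m₁) (hk : k ∈ G.uSet c₁ m₁)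
    (h : G.Chain c₁ m₁ x y) (hyk : G.dir y k ≠ 0) : (G.reduce c₁ m₁).dir x k ≠ 0 :=
  (reduce_dir_ne_zero hG).2 ⟨hx, .inl hk, full_inl_inr.2 ⟨y, h, .single hyk⟩⟩

theorem chain_of_dir (hG : IsSummaryGraph G) (hk : k ∈ G.uSet c₁ m₁)
    (h : (G.reduce c₁ m₁).dir x k ≠ 0) : ∃ y, G.Chain c₁ m₁ x y ∧ G.dir y k ≠ 0 :=
  (full_inl_inr_of_mem_oSet hG (uSet_subset_oSet hk)).1 ((reduce_dir_ne_zero hG).1 h).2.2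

/-- A new ancestor of the conditioning set is reached from a remaining one through
marginalised nodes. -/
theorem exists_chain_of_mem_rSet (hG : IsSummaryGraph G) (hc : Disjoint c₂ m₁)
    (hj : j ∈ G.rSet (c₁ ∪ c₂)) (hj₁ : j ∉ G.rSet c₁) :
    ∃ s ∈ (G.reduce c₁ m₁).rSet c₂, G.Chain c₁ m₁ s j := by
  obtain ⟨hju, t, ht, h⟩ := mem_rSet.1 hj
  have ht₁ : t ∉ G.rSet c₁ := fun h' => hj₁ (rSet_of_reflTransGen h' h)
  obtain ⟨htc, htu⟩ := Finset.mem_inter.1 ht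
  have htc₂ : t ∈ c₂ :=
    (Finset.mem_union.1 htc).resolve_left fun h => ht₁ (rSet_of_mem h htu)
  have htu₁ : t ∈ G.uSet c₁ m₁ := mem_uSet.2 ⟨⟨htu, ht₁⟩, Finset.disjoint_left.1 hc htc₂⟩
  clear hj hju
  induction h with
  | refl =>
    exact ⟨t, mem_rSet.2 ⟨htu₁, t, Finset.mem_inter.2 ⟨htc₂, htu₁⟩, .refl⟩, .refl⟩
  | @tail b d _ hbd ih =>
    obtain ⟨s, hs, hsb⟩ := ih fun h => hj₁ (rSet_of_dir h hbd.2.1 hbd.2.2)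
    by_cases hd : d ∈ m₁
    · exact ⟨s, hs, hsb.tail ⟨hbd.2.2, mem_hSet.2 ⟨⟨hbd.2.1, hj₁⟩, hd⟩⟩⟩
    · have hdu : d ∈ G.uSet c₁ m₁ := mem_uSet.2 ⟨⟨hbd.2.1, hj₁⟩, hd⟩
      exact ⟨d, rSet_of_dir hs hdu (dir_of_chain hG (rSet_subset hs) hdu hsb hbd.2.2), .refl⟩

/-- Arrows of the reduced graph within its `u` are chains followed by an arrow, so they preserve
ancestry in `G`; the converse uses that a chain ending outside `m₁` is trivial. -/
theorem mem_rSet_reduce (hG : IsSummaryGraph G) (hc : Disjoint c₂ m₁) :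
    j ∈ (G.reduce c₁ m₁).rSet c₂ ↔ j ∈ G.uSet c₁ m₁ ∧ j ∈ G.rSet (c₁ ∪ c₂) := by
  constructor
  · intro hjr
    obtain ⟨hj, t, ht, h⟩ := mem_rSet.1 hjr
    refine ⟨hj, ?_⟩
    obtain ⟨htc, htu⟩ := Finset.mem_inter.1 ht
    clear hj hjr
    induction h with
    | refl => exact rSet_of_mem (Finset.mem_union_right _ htc) (uSet_subset_u htu)
    | tail _ hbd ih =>
      obtain ⟨y, hy, hyd⟩ := chain_of_dir hG hbd.2.1 hbd.2.2
      exact rSet_of_dir (rSet_of_chain ih hy) (uSet_subset_u hbd.2.1) hyd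
  · rintro ⟨hj, h⟩
    obtain ⟨hj', hjm⟩ := mem_uSet.1 hj
    obtain ⟨s, hs, hsj⟩ := exists_chain_of_mem_rSet hG hc h hj'.2
    rcases ReflTransGen.cases_tail hsj with rfl | ⟨_, -, -, h⟩
    exacts [hs, absurd (mem_hSet.1 h).2 hjm]

variable (hG : IsSummaryGraph G) (hd : Disjoint (c₁ ∪ c₂) (m₁ ∪ m₂))
include hG hd

theorem mem_rSet_reduce_of_disjoint :
    j ∈ (G.reduce c₁ m₁).rSet c₂ ↔ j ∈ G.uSet c₁ m₁ ∧ j ∈ G.rSet (c₁ ∪ c₂) :=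
  mem_rSet_reduce hG (hd.mono Finset.subset_union_right Finset.subset_union_left)

omit hG in
theorem not_mem_of_mem (h : i ∈ c₁ ∨ i ∈ c₂) : i ∉ m₁ ∧ i ∉ m₂ := by
  have := Finset.disjoint_left.1 hd (Finset.mem_union.2 h)
  simpa using this

theorem mem_uSet_reduce :
    i ∈ (G.reduce c₁ m₁).uSet c₂ m₂ ↔ i ∈ G.uSet (c₁ ∪ c₂) (m₁ ∪ m₂) := by
  have hu : (G.reduce c₁ m₁).u = G.uSet c₁ m₁ := rfl
  have := @rSet_mono _ _ _ G c₁ c₂ i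
  rw [mem_uSet, mem_rSet_reduce_of_disjoint hG hd, hu, mem_uSet, mem_uSet, Finset.mem_union]
  tauto

theorem mem_vSet_reduce :
    i ∈ (G.reduce c₁ m₁).vSet c₂ m₂ ↔ i ∈ G.vSet (c₁ ∪ c₂) (m₁ ∪ m₂) := by
  have hv : (G.reduce c₁ m₁).v = G.vSet c₁ m₁ := rfl
  have h1 := @rSet_mono _ _ _ G c₁ c₂ i
  have h2 := @rSet_of_mem _ _ _ G c₁ i
  have h3 := @rSet_subset _ _ _ G (c₁ ∪ c₂) i
  rw [mem_vSet, mem_rSet_reduce_of_disjoint hG hd, hv, mem_vSet, mem_vSet, mem_uSet,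
    Finset.mem_union, Finset.mem_union]
  tauto

omit hG in
theorem pass_of_pass (h : G.Pass c₁ m₁ z) : G.Pass (c₁ ∪ c₂) (m₁ ∪ m₂) z := by
  rcases z with z | z <;> rcases h with h | h
  · exact .inl (rSet_mono h)
  · exact h.elim
  · exact h.elim
  · refine .inr (mem_lSet.2 ?_)
    have h := mem_lSet.1 h
    have h1 := @rSet_mono _ _ _ G c₁ c₂ z
    have h2 := @not_mem_of_mem _ _ _ c₁ m₁ c₂ m₂ z hd
    rw [Finset.mem_union, Finset.mem_union]
    tauto

theorem pass_of_pass_reduce (h : (G.reduce c₁ m₁).Pass c₂ m₂ z) :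
    G.Pass (c₁ ∪ c₂) (m₁ ∪ m₂) z := by
  rcases z with z | z <;> rcases h with h | h
  · exact .inl ((mem_rSet_reduce_of_disjoint hG hd).1 h).2
  · exact h.elim
  · exact h.elim
  · refine .inr (mem_lSet.2 ?_)
    have hv : (G.reduce c₁ m₁).v = G.vSet c₁ m₁ := rfl
    have h := mem_lSet.1 h
    rw [mem_rSet_reduce_of_disjoint hG hd, hv, mem_vSet, mem_uSet] at h
    have h1 := @rSet_mono _ _ _ G c₁ c₂ z
    have h2 := @not_mem_of_mem _ _ _ c₁ m₁ c₂ m₂ z hd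
    rw [Finset.mem_union, Finset.mem_union]
    tauto

omit hG in
theorem core_of_core (h : G.Core c₁ m₁ a b) : G.Core (c₁ ∪ c₂) (m₁ ∪ m₂) a b :=
  Thru.mono (fun _ => pass_of_pass hd) (fun _ _ => id) h

/-- As `r` is closed under parents, a chain entering the enlarged `r` never leaves it. The part
before entry remains a chain, and the part after becomes a core path. -/
theorem chain_of_chain (h : G.Chain c₁ m₁ x y) : ∃ x₀, G.Chain (c₁ ∪ c₂) (m₁ ∪ m₂) x x₀ ∧
    (x₀ = y ∨ y ∈ G.rSet (c₁ ∪ c₂) ∧ G.Core (c₁ ∪ c₂) (m₁ ∪ m₂) (inl x₀) (inl y)) := by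
  induction h with
  | refl => exact ⟨x, .refl, .inl rfl⟩
  | @tail b d _ hbd ih =>
    obtain ⟨x₀, hx, ih⟩ := ih
    obtain ⟨⟨hdu, -⟩, hdm⟩ := mem_hSet.1 hbd.2
    by_cases hdr : d ∈ G.rSet (c₁ ∪ c₂)
    · have hstep : G.Core (c₁ ∪ c₂) (m₁ ∪ m₂) (inl b) (inl d) := by
        -- The detour: from the residual of `b` to the variable `d`, now in `l`, and on to the
        -- residual of `d` by the diagonal arrow.
        refine Thru.tail (j := inr d) (.single hbd.1) (.inr (mem_lSet.2 ⟨⟨.inl hdr, fun h => ?_⟩,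
          Finset.mem_union_left _ hdm⟩)) (dir_self hG hdu)
        exact (not_mem_of_mem hd (Finset.mem_union.1 h)).1 hdm
      refine ⟨x₀, hx, .inr ⟨hdr, ?_⟩⟩
      rcases ih with rfl | ⟨hb, h⟩
      exacts [hstep, Thru.trans h (.inl hb) hstep]
    · have hb : b ∉ G.rSet (c₁ ∪ c₂) := fun h => hdr (rSet_of_dir h hdu hbd.1)
      obtain rfl := ih.resolve_right fun h => hb h.1
      exact ⟨d, hx.tail ⟨hbd.1, mem_hSet.2 ⟨⟨hdu, hdr⟩, Finset.mem_union_left _ hdm⟩⟩, .inl rfl⟩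

theorem lift_of_lift (h : G.Lift c₁ m₁ a b) : ∃ a₀, G.Lift (c₁ ∪ c₂) (m₁ ∪ m₂) a a₀ ∧
    (a₀ = b ∨ G.Pass (c₁ ∪ c₂) (m₁ ∪ m₂) b ∧ G.Core (c₁ ∪ c₂) (m₁ ∪ m₂) a₀ b) := by
  rcases a with a | a <;> rcases b with b | b
  · obtain ⟨x₀, h1, rfl | h2⟩ := chain_of_chain hG hd h
    exacts [⟨inl x₀, h1, .inl rfl⟩, ⟨inl x₀, h1, .inr ⟨.inl h2.1, h2.2⟩⟩]
  · exact h.elim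
  · exact h.elim
  · exact ⟨inr a, rfl, .inl (congrArg _ h)⟩

theorem full_of_full (h : G.Full c₁ m₁ a b) : G.Full (c₁ ∪ c₂) (m₁ ∪ m₂) a b := by
  obtain ⟨a₀, b₀, h1, h2, h3⟩ := h
  obtain ⟨a₁, ha, ha'⟩ := lift_of_lift hG hd h1
  obtain ⟨b₁, hb, hb'⟩ := lift_of_lift hG hd h3
  have h4 : G.Core (c₁ ∪ c₂) (m₁ ∪ m₂) a₁ b₀ := by
    rcases ha' with rfl | ha'
    exacts [core_of_core hd h2, Thru.trans ha'.2 ha'.1 (core_of_core hd h2)]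
  refine ⟨a₁, b₁, ha, ?_, hb⟩
  rcases hb' with rfl | hb'
  exacts [h4, Thru.trans h4 hb'.1 (core_symm hG hb'.2)]

theorem full_of_core_reduce (h : (G.reduce c₁ m₁).Core c₂ m₂ a b) :
    G.Full (c₁ ∪ c₂) (m₁ ∪ m₂) a b :=
  h.induction (P := G.Full (c₁ ∪ c₂) (m₁ ∪ m₂) a)
    (fun _ hx => full_of_full hG hd ((reduce_splitAdj hG).1 hx).2.2)
    fun _ _ ih hx hxy => Full_trans ih (pass_of_pass_reduce hG hd hx)
      (full_of_full hG hd ((reduce_splitAdj hG).1 hxy).2.2)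

theorem chain_of_chain_reduce (h : (G.reduce c₁ m₁).Chain c₂ m₂ x y) :
    G.Chain (c₁ ∪ c₂) (m₁ ∪ m₂) x y := by
  induction h with
  | refl => exact .refl
  | @tail b d _ hbd ih =>
    obtain ⟨⟨hdu, hdr⟩, hdm⟩ := mem_hSet.1 hbd.2
    rw [mem_rSet_reduce_of_disjoint hG hd] at hdr
    have hdr' : d ∉ G.rSet (c₁ ∪ c₂) := fun h => hdr ⟨hdu, h⟩
    obtain ⟨w, hw, hwd⟩ := chain_of_dir hG hdu hbd.1
    -- The node `d` lies outside the enlarged `r`, hence so does its child `w`; this excludes the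
    -- core alternative for the chain ending at `w`.
    have hwr : w ∉ G.rSet (c₁ ∪ c₂) := fun h => hdr' (rSet_of_dir h (uSet_subset_u hdu) hwd)
    obtain ⟨_, h1, h2⟩ := chain_of_chain hG hd hw
    obtain rfl := h2.resolve_right fun h => hwr h.1
    exact (ReflTransGen.trans ih h1).tail ⟨hwd, mem_hSet.2 ⟨⟨uSet_subset_u hdu, hdr'⟩,
      Finset.mem_union_right _ hdm⟩⟩

theorem lift_of_lift_reduce (h : (G.reduce c₁ m₁).Lift c₂ m₂ a b) :
    G.Lift (c₁ ∪ c₂) (m₁ ∪ m₂) a b := by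
  rcases a with a | a <;> rcases b with b | b
  exacts [chain_of_chain_reduce hG hd h, h.elim, h.elim, h]

theorem full_of_full_reduce (h : (G.reduce c₁ m₁).Full c₂ m₂ a b) :
    G.Full (c₁ ∪ c₂) (m₁ ∪ m₂) a b := by
  obtain ⟨a₀, b₀, h1, h2, h3⟩ := h
  exact Full_lift_left (Full_lift_right (full_of_core_reduce hG hd h2)
    (lift_of_lift_reduce hG hd h3)) (lift_of_lift_reduce hG hd h1)

/-- The cut is made at the last node of the chain outside `m₁`, or at its start if there is none. -/
theorem chain_split (hi : i ∈ G.uSet c₁ m₁) (h : G.Chain (c₁ ∪ c₂) (m₁ ∪ m₂) i x) :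
    ∃ s ∈ G.uSet c₁ m₁, (G.reduce c₁ m₁).Chain c₂ m₂ i s ∧ G.Chain c₁ m₁ s x := by
  induction h with
  | refl => exact ⟨i, hi, .refl, .refl⟩
  | @tail b d _ hbd ih =>
    obtain ⟨s, hs, h1, h2⟩ := ih
    obtain ⟨⟨hdu, hdr⟩, hdm⟩ := mem_hSet.1 hbd.2
    have hdr₁ : d ∉ G.rSet c₁ := fun h => hdr (rSet_mono h)
    by_cases hdm₁ : d ∈ m₁
    · exact ⟨s, hs, h1, h2.tail ⟨hbd.1, mem_hSet.2 ⟨⟨hdu, hdr₁⟩, hdm₁⟩⟩⟩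
    · have hdu₁ : d ∈ G.uSet c₁ m₁ := mem_uSet.2 ⟨⟨hdu, hdr₁⟩, hdm₁⟩
      refine ⟨d, hdu₁, h1.tail ⟨dir_of_chain hG hs hdu₁ h2 hbd.1, mem_hSet.2 ⟨⟨hdu₁, ?_⟩,
        (Finset.mem_union.1 hdm).resolve_left hdm₁⟩⟩, .refl⟩
      rw [mem_rSet_reduce_of_disjoint hG hd]
      exact fun h => hdr h.2

omit hG hd in
theorem isVertex_of_isVertex (h : G.IsVertex (c₁ ∪ c₂) (m₁ ∪ m₂) a) : G.IsVertex c₁ m₁ a := by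
  have h1 := @rSet_mono _ _ _ G c₁ c₂
  have h2 := @rSet_subset _ _ _ G (c₁ ∪ c₂)
  rcases a with i | i <;> simp only [IsVertex, mem_uSet, mem_vSet, Finset.mem_union] at h ⊢ <;>
    specialize @h1 i <;> specialize @h2 i <;> tauto

theorem lift_split (ha : G.IsVertex (c₁ ∪ c₂) (m₁ ∪ m₂) a)
    (h : G.Lift (c₁ ∪ c₂) (m₁ ∪ m₂) a b) :
    ∃ s, G.IsVertex c₁ m₁ s ∧ (G.reduce c₁ m₁).Lift c₂ m₂ a s ∧ G.Lift c₁ m₁ s b := by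
  have ha₁ := isVertex_of_isVertex ha
  rcases a with a | a <;> rcases b with b | b
  · obtain ⟨s, h1, h2, h3⟩ := chain_split hG hd ha₁ h
    exact ⟨inl s, h1, h2, h3⟩
  · exact h.elim
  · exact h.elim
  · exact ⟨inr a, ha₁, rfl, h⟩

/-- A path of the reduction of `G` by `[c₁ ∪ c₂, m₁ ∪ m₂]` is cut into edges of the reduction by
`[c₁, m₁]`. -/
theorem core_reduce_of_core {a₀ b₀ : V ⊕ V} (ha : G.IsVertex c₁ m₁ a)
    (hb : G.IsVertex c₁ m₁ b) (haa : G.Lift c₁ m₁ a a₀) (hbb : G.Lift c₁ m₁ b b₀)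
    (h : G.Core (c₁ ∪ c₂) (m₁ ∪ m₂) a₀ b₀) : (G.reduce c₁ m₁).Core c₂ m₂ a b := by
  -- closing an edge of the reduced graph
  have close : ∀ t w, G.IsVertex c₁ m₁ t →
      (t = a ∨ (G.reduce c₁ m₁).Core c₂ m₂ a t ∧ (G.reduce c₁ m₁).Pass c₂ m₂ t) →
      G.Full c₁ m₁ t w → G.IsVertex c₁ m₁ w → (G.reduce c₁ m₁).Core c₂ m₂ a w := by
    intro t w ht hat htw hw
    have hadj := (reduce_splitAdj hG).2 ⟨ht, hw, htw⟩
    rcases hat with rfl | hat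
    exacts [.single hadj, Thru.tail hat.1 hat.2 hadj]
  -- The invariant along the path keeps the last cut vertex `t` and the still open first-step
  -- connection from `t` to the current vertex.
  suffices hinv : ∃ t, G.IsVertex c₁ m₁ t ∧
      (t = a ∨ (G.reduce c₁ m₁).Core c₂ m₂ a t ∧ (G.reduce c₁ m₁).Pass c₂ m₂ t) ∧
      G.Full c₁ m₁ t b₀ by
    obtain ⟨t, ht, hat, htb⟩ := hinv
    exact close t b ht hat (Full_lift_right htb hbb) hb
  refine h.induction (P := fun w => ∃ t, G.IsVertex c₁ m₁ t ∧
      (t = a ∨ (G.reduce c₁ m₁).Core c₂ m₂ a t ∧ (G.reduce c₁ m₁).Pass c₂ m₂ t) ∧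
      G.Full c₁ m₁ t w) ?_ ?_
  · exact fun w hw => ⟨a, ha, .inl rfl, Full_lift_left (full_of_core (.single hw)) haa⟩
  rintro w w' ⟨t, ht, hat, htw⟩ hw hadj
  by_cases hw₁ : G.Pass c₁ m₁ w
  · exact ⟨t, ht, hat, Full_tail htw hw₁ hadj⟩
  rcases w with j | j
  · have hj : j ∈ G.rSet (c₁ ∪ c₂) := hw.resolve_right id
    -- The residual of `j` may itself not survive, so the cut is made at the residual of a surviving
    -- `s` with a chain to `j`; the same chain closes the old edge and opens the next.
    obtain ⟨s, hs, hsj⟩ := exists_chain_of_mem_rSet hG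
      (hd.mono Finset.subset_union_right Finset.subset_union_left) hj fun h => hw₁ (.inl h)
    have hsu : G.IsVertex c₁ m₁ (inl s) := rSet_subset hs
    exact ⟨inl s, hsu, .inr ⟨close t _ ht hat
      (Full_lift_right htw (show G.Lift c₁ m₁ (inl s) (inl j) from hsj)) hsu, .inl hs⟩,
      Full_lift_left (full_of_core (.single hadj)) hsj⟩
  · have hj : j ∈ G.lSet (c₁ ∪ c₂) (m₁ ∪ m₂) := hw.resolve_left id
    have hjl : j ∉ G.lSet c₁ m₁ := fun h => hw₁ (.inr h)
    have hv : (G.reduce c₁ m₁).v = G.vSet c₁ m₁ := rfl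
    -- the variable `j` remains and is marginalised in the second step
    have remain : j ∈ (G.reduce c₁ m₁).lSet c₂ m₂ →
        ∃ t, G.IsVertex c₁ m₁ t ∧
        (t = a ∨ (G.reduce c₁ m₁).Core c₂ m₂ a t ∧ (G.reduce c₁ m₁).Pass c₂ m₂ t) ∧
        G.Full c₁ m₁ t w' := by
      intro h
      have hjv : G.IsVertex c₁ m₁ (inr j) :=
        (mem_lSet.1 h).1.1.imp (fun h => ((mem_rSet_reduce_of_disjoint hG hd).1 h).1) id
      exact ⟨inr j, hjv, .inr ⟨close t _ ht hat htw hjv, .inr h⟩, full_of_core (.single hadj)⟩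
    rw [mem_lSet] at hj hjl
    rw [mem_lSet, mem_rSet_reduce_of_disjoint hG hd, hv, mem_uSet, mem_vSet] at remain
    obtain ⟨⟨hjrv, hjc⟩, hjm₁₂⟩ := hj
    rw [Finset.mem_union, not_or] at hjc
    by_cases hjm : j ∈ m₁
    swap
    · refine remain ⟨⟨?_, hjc.2⟩, (Finset.mem_union.1 hjm₁₂).resolve_left hjm⟩
      by_cases hjr : j ∈ G.rSet c₁
      · exact .inr ⟨⟨.inl hjr, hjc.1⟩, hjm⟩
      · exact hjrv.imp (fun h => ⟨⟨⟨rSet_subset h, hjr⟩, hjm⟩, h⟩) fun h => ⟨⟨.inr h, hjc.1⟩, hjm⟩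
    have hjr₁ : j ∉ G.rSet c₁ := fun h => hjl ⟨⟨.inl h, hjc.1⟩, hjm⟩
    have hjv : j ∉ G.v := fun h => hjl ⟨⟨.inr h, hjc.1⟩, hjm⟩
    have hjr : j ∈ G.rSet (c₁ ∪ c₂) ∧ j ∉ G.rSet c₁ ∧ j ∉ G.v :=
      ⟨hjrv.resolve_right hjv, hjr₁, hjv⟩
    have hju := rSet_subset hjr.1
    have hjo : j ∈ G.oSet c₁ := mem_oSet.2 ⟨hju, hjr.2.1⟩
    have hjh : j ∈ G.hSet c₁ m₁ := mem_hSet.2 ⟨⟨hju, hjr.2.1⟩, hjm⟩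
    -- Here `j` is eliminated by the first step outside its `r`. The path must enter and leave the
    -- variable `j` through arrows into residuals; both chains are extended to `j` and joined by the
    -- dashed loop there.
    obtain ⟨t', y, rfl, hy, hyj⟩ := full_inr_of_mem_oSet hG hjo htw
    rcases w' with y' | k
    · refine ⟨_, ht, hat, full_inl_inl.2 ⟨j, j, hy.tail ⟨hyj, hjh⟩, .single (dash_self hG hju), ?_⟩⟩
      exact .single ⟨hadj, hjh⟩
    · exact absurd (hG.full_supp _ _ hadj).1 hjr.2.2

theorem full_reduce_iff (ha : G.IsVertex (c₁ ∪ c₂) (m₁ ∪ m₂) a)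
    (hb : G.IsVertex (c₁ ∪ c₂) (m₁ ∪ m₂) b) :
    (G.reduce c₁ m₁).Full c₂ m₂ a b ↔ G.Full (c₁ ∪ c₂) (m₁ ∪ m₂) a b := by
  refine ⟨full_of_full_reduce hG hd, ?_⟩
  rintro ⟨a₀, b₀, h1, h2, h3⟩
  obtain ⟨a₁, ha₁, h4, h5⟩ := lift_split hG hd ha h1
  obtain ⟨b₁, hb₁, h6, h7⟩ := lift_split hG hd hb h3
  exact ⟨a₁, b₁, h4, core_reduce_of_core hG hd ha₁ hb₁ h5 h7 h2, h6⟩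

theorem splitAdj_reduce_reduce : ((G.reduce c₁ m₁).reduce c₂ m₂).splitAdj a b ↔
    (G.reduce (c₁ ∪ c₂) (m₁ ∪ m₂)).splitAdj a b := by
  have hv : ∀ a, (G.reduce c₁ m₁).IsVertex c₂ m₂ a ↔ G.IsVertex (c₁ ∪ c₂) (m₁ ∪ m₂) a := by
    rintro (i | i)
    · exact mem_uSet_reduce hG hd
    · exact or_congr (mem_uSet_reduce hG hd) (mem_vSet_reduce hG hd)
  rw [reduce_splitAdj (isSummaryGraph_reduce hG), reduce_splitAdj hG, hv, hv]
  exact and_congr_right fun ha => and_congr_right fun hb => full_reduce_iff hG hd ha hb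

omit hG hd in
theorem eq_of_splitAdj {H : EdgeMatrices V} (hG : IsSummaryGraph G) (hH : IsSummaryGraph H)
    (hu : G.u = H.u) (hv : G.v = H.v) (h : ∀ a b, G.splitAdj a b ↔ H.splitAdj a b) : G = H :=
  EdgeMatrices.ext hu hv
    (eq_of_binary hG.dir_binary hH.dir_binary fun i k => h (inl i) (inr k))
    (eq_of_binary hG.dash_binary hH.dash_binary fun i k => h (inl i) (inl k))
    (eq_of_binary hG.full_binary hH.full_binary fun i k => h (inr i) (inr k))

theorem reduce_reduce :
    (G.reduce c₁ m₁).reduce c₂ m₂ = G.reduce (c₁ ∪ c₂) (m₁ ∪ m₂) :=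
  eq_of_splitAdj (isSummaryGraph_reduce (isSummaryGraph_reduce hG)) (isSummaryGraph_reduce hG)
    (Finset.ext fun _ => mem_uSet_reduce hG hd) (Finset.ext fun _ => mem_vSet_reduce hG hd)
    fun _ _ => splitAdj_reduce_reduce hG hd

end TwoSteps

end EdgeMatrices

end SummaryGraphs

namespace SummaryGraphs

open EdgeMatrices Relation Sum

/-! ### Directed acyclic graphs as summary graphs -/

section Parent

variable {V : Type*} [Fintype V] [LinearOrder V]

/-- A parent graph as a summary graph without full lines and with dashed loops only. -/
def parentGraph (A : Matrix V V ℝ) : EdgeMatrices V :=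
  { u := Finset.univ, v := ∅, dir := A, dash := 1, full := 0 }

variable {A : Matrix V V ℝ} {C M : Finset V} {i j k x y : V}

theorem isSummaryGraph_parentGraph (hA : IsParentEdgeMatrix A) :
    IsSummaryGraph (parentGraph A) where
  disjoint := Finset.disjoint_empty_right _
  dir_binary := hA.binary
  dash_binary i k := by
    change (1 : Matrix V V ℝ) i k = 0 ∨ (1 : Matrix V V ℝ) i k = 1
    rw [Matrix.one_apply]; split_ifs <;> simp
  full_binary _ _ := .inl rfl
  dir_supp _ _ _ := by simp [parentGraph]
  dash_supp _ _ _ := by simp [parentGraph]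
  full_supp _ _ h := absurd rfl h
  dir_diag i _ := hA.diag i
  dash_diag i _ := Matrix.one_apply_eq i
  full_diag i h := absurd h (Finset.notMem_empty i)
  dir_upper i _ k _ := hA.upper i k
  dash_symm i k := by
    change (1 : Matrix V V ℝ) i k = (1 : Matrix V V ℝ) k i
    rw [Matrix.one_apply, Matrix.one_apply]; simp [eq_comm]
  full_symm _ _ := rfl

theorem mem_nodes_parentGraph : i ∈ (parentGraph A).nodes :=
  Finset.mem_union_left _ (Finset.mem_univ i)

theorem rSet_parentGraph : (parentGraph A).rSet C = C ∪ foster A Finset.univ C := by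
  simp [rSet, parentGraph]

theorem phiSet_parentGraph : (parentGraph A).phiSet C = foster A Finset.univ C := by
  ext i
  have h : i ∈ foster A Finset.univ C → i ∉ C := fun h => by
    simp only [foster, Finset.mem_filter] at h
    exact h.2.1
  have hv : i ∉ (parentGraph A).v := Finset.notMem_empty i
  rw [mem_phiSet, rSet_parentGraph, Finset.mem_union]
  tauto

theorem oSet_parentGraph : (parentGraph A).oSet C = (C ∪ foster A Finset.univ C)ᶜ := by
  ext i
  have hu : i ∈ (parentGraph A).u := Finset.mem_univ i
  rw [mem_oSet, rSet_parentGraph, Finset.mem_compl]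
  tauto

variable (hA : IsParentEdgeMatrix A)
include hA

theorem Q_parentGraph : (parentGraph A).Q C x y ≠ 0 ↔ x = y := by
  rw [Q_ne_zero (isSummaryGraph_parentGraph hA)]
  constructor
  · intro h
    exact h.induction (P := fun y => x = y) (fun _ h => one_ne_zero_iff.1 h)
      fun _ _ h _ h' => h.trans (one_ne_zero_iff.1 h')
  · intro h
    exact .single (one_ne_zero_iff.2 h)

theorem thru_residual_parentGraph_inl_inr :
    Thru ((parentGraph A).ResidualPass C) (parentGraph A).splitAdj (inl x) (inr k) ↔
      A x k ≠ 0 := by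
  refine (thru_residual_inl (isSummaryGraph_parentGraph hA)).trans ⟨?_, .inl⟩
  rintro (h | ⟨y, -, hxy, h⟩)
  · exact h
  · exact (Q_parentGraph hA).1 hxy ▸ h

/-- With `Q` supported on the diagonal and no full lines, the induced matrix on `r` has the support
of `A_RRᵀ A_RR`. -/
theorem Z_parentGraph : (parentGraph A).Z C M = zer ((parentGraph A).lSet C M)
    (blk ((parentGraph A).phiSet C) ((parentGraph A).phiSet C)
      (ind ((blk ((parentGraph A).rSet C) ((parentGraph A).rSet C) A)ᵀ
        * blk ((parentGraph A).rSet C) ((parentGraph A).rSet C) A))) := by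
  have hG := isSummaryGraph_parentGraph hA
  have := nonnegEntries_of_binary hA.binary
  refine congrArg (zer _) (eq_of_binary (fun i j => blk_binary (ind_binary _ i j))
    (fun i j => blk_binary (ind_binary _ i j)) fun i k => ?_)
  rw [blk_ne_zero, blk_ne_zero]
  refine and_congr_right fun hi => and_congr_right fun hk => ?_
  have hv : ∀ i, i ∈ (parentGraph A).phiSet C → i ∈ (parentGraph A).rSet C := fun i hi =>
    (mem_phiSet.1 hi).1.resolve_right (Finset.notMem_empty i)
  rw [Spsi_ne_zero hG (phiSet_subset_psiSet hi) (phiSet_subset_psiSet hk),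
    thru_residual_inr_inr hG, ind_ne_zero, mul_ne_zero]
  simp only [transpose_ne_zero, blk_ne_zero, Q_parentGraph hA]
  constructor
  · rintro (h | ⟨x, hx, y, -, h1, rfl, h2⟩)
    exacts [absurd rfl h, ⟨x, ⟨hx, hv i hi, h1⟩, hx, hv k hk, h2⟩]
  · rintro ⟨x, ⟨hx, -, h1⟩, -, -, h2⟩
    exact .inr ⟨x, hx, x, hx, h1, rfl, h2⟩

theorem zer_parent_ne_zero (hi : i ∈ (parentGraph A).uSet C M) :
    zer ((parentGraph A).hSet C M) A i k ≠ 0 ↔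
      ∃ x, (parentGraph A).Chain C M i x ∧ A x k ≠ 0 := by
  have := nonnegEntries_of_binary hA.binary
  rw [zer_ne_zero (binary_le_one hA.binary)]
  exact or_iff_right fun h => (Finset.mem_sdiff.1 hi).2 h.2

theorem full_parentGraph_inl_inr (hi : i ∈ (parentGraph A).uSet C M) :
    (parentGraph A).Full C M (inl i) (inr k) ↔ zer ((parentGraph A).hSet C M) A i k ≠ 0 ∨
      ∃ y ∈ (parentGraph A).lSet C M, zer ((parentGraph A).hSet C M) A i y ≠ 0 ∧
        (parentGraph A).Core C M (inr y) (inr k) := by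
  simp only [full_inl_inr, core_inl_inr, thru_residual_parentGraph_inl_inr hA,
    zer_parent_ne_zero hA hi]
  grind

theorem chain_parentGraph (hi : i ∈ (parentGraph A).uSet C M) :
    (parentGraph A).Chain C M i x ↔ x = i ∨ x ∈ (parentGraph A).hSet C M ∧
      zer ((parentGraph A).hSet C M) A i x ≠ 0 := by
  have hG := isSummaryGraph_parentGraph hA
  rw [chain_iff_of_mem_uSet hG hi]
  refine or_congr_right (and_congr_right fun hx => ?_)
  have hxo := (Finset.mem_inter.1 hx).1
  rw [K_ne_zero_iff_full hG hi (.inl hxo), full_inl_inr_of_mem_oSet hG hxo,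
    zer_parent_ne_zero hA hi]
  rfl

theorem K_parentGraph_ne_zero (hi : i ∈ (parentGraph A).uSet C M)
    (hk : k ∈ (parentGraph A).lSet C M) : (parentGraph A).K C M i k ≠ 0 ↔
      ∃ y ∈ (parentGraph A).lSet C M, zer ((parentGraph A).hSet C M) A i y ≠ 0 ∧
        (parentGraph A).Core C M (inr y) (inr k) := by
  have hG := isSummaryGraph_parentGraph hA
  rw [K_ne_zero_iff_full hG hi (.inr (lSet_subset_phiSet hk)), full_parentGraph_inl_inr hA hi]
  refine or_iff_right_of_imp fun h => ⟨k, hk, h, ?_⟩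
  exact core_inr_self hG (phiSet_subset_psiSet (lSet_subset_phiSet hk))

/-- `K_ul` differs from `D_ul` by core paths between variables of `l`. On both sides these are
absorbed into `Z`, whose paths compose through `l`. -/
theorem dash_parentGraph_ne_zero (hi : i ∈ (parentGraph A).uSet C M)
    (hj : j ∈ (parentGraph A).uSet C M) : (parentGraph A).Full C M (inl i) (inl j) ↔
      i = j ∨ (∃ x ∈ (parentGraph A).hSet C M, zer ((parentGraph A).hSet C M) A i x ≠ 0 ∧
        zer ((parentGraph A).hSet C M) A j x ≠ 0) ∨
      ∃ p ∈ (parentGraph A).lSet C M, ∃ q ∈ (parentGraph A).lSet C M,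
        zer ((parentGraph A).hSet C M) A i p ≠ 0 ∧ (parentGraph A).Z C M p q ≠ 0 ∧
        zer ((parentGraph A).hSet C M) A j q ≠ 0 := by
  have hG := isSummaryGraph_parentGraph hA
  have hih : i ∉ (parentGraph A).hSet C M := (Finset.mem_sdiff.1 hi).2
  have hjh : j ∉ (parentGraph A).hSet C M := (Finset.mem_sdiff.1 hj).2
  rw [full_inl_inl_iff hG hi hj, ← or_assoc]
  refine or_congr ?_ ?_
  · simp only [Q_parentGraph hA, chain_parentGraph hA hi, chain_parentGraph hA hj]
    grind
  · constructor
    · rintro ⟨p, hp, q, hq, h1, h2, h3⟩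
      obtain ⟨p', hp', h1, h4⟩ := (K_parentGraph_ne_zero hA hi hp).1 h1
      obtain ⟨q', hq', h3, h5⟩ := (K_parentGraph_ne_zero hA hj hq).1 h3
      rw [Z_ne_zero hG (lSet_subset_phiSet hp) (lSet_subset_phiSet hq)] at h2
      refine ⟨p', hp', q', hq', h1, ?_, h3⟩
      rw [Z_ne_zero hG (lSet_subset_phiSet hp') (lSet_subset_phiSet hq')]
      exact (Thru.trans h4 (.inr hp) h2).trans (.inr hq) (core_symm hG h5)
    · rintro ⟨p, hp, q, hq, h1, h2, h3⟩
      have hself : ∀ {p}, p ∈ (parentGraph A).lSet C M →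
          (parentGraph A).Core C M (inr p) (inr p) := fun hp =>
        core_inr_self hG (phiSet_subset_psiSet (lSet_subset_phiSet hp))
      exact ⟨p, hp, q, hq, (K_parentGraph_ne_zero hA hi hp).2 ⟨p, hp, h1, hself hp⟩, h2,
        (K_parentGraph_ne_zero hA hj hq).2 ⟨q, hq, h3, hself hq⟩⟩

theorem ofParent_eq_reduce : ofParent A C M = (parentGraph A).reduce C M := by
  have hG := isSummaryGraph_parentGraph hA
  have hR := rSet_parentGraph (A := A) (C := C)
  have hF := phiSet_parentGraph (A := A) (C := C)
  have hO := oSet_parentGraph (A := A) (C := C)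
  have hZ := Z_parentGraph hA (C := C) (M := M)
  set G := parentGraph A with hGA
  set D := zer (G.hSet C M) A with hD
  have hof : ofParent A C M =
      { u := G.uSet C M
        v := G.vSet C M
        dir := blk (G.uSet C M) (G.uSet C M) D + ind (blk (G.uSet C M) (G.vSet C M) D
          + blk (G.uSet C M) (G.lSet C M) D * blk (G.lSet C M) (G.vSet C M) (G.Z C M))
        dash := ind ((blk (G.uSet C M) (G.uSet C M) 1
          + blk (G.uSet C M) (G.hSet C M) D * (blk (G.uSet C M) (G.hSet C M) D)ᵀ)
          + blk (G.uSet C M) (G.lSet C M) D * blk (G.lSet C M) (G.lSet C M) (G.Z C M)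
            * (blk (G.uSet C M) (G.lSet C M) D)ᵀ)
        full := blk (G.vSet C M) (G.vSet C M) (G.Z C M) } := by
    rw [hZ, hD]
    simp only [ofParent, uSet, vSet, hSet, lSet, hR, hF, hO]
  have hDn : NonnegEntries D := by rw [hD]; infer_instance
  have hZn : NonnegEntries (G.Z C M) := by unfold EdgeMatrices.Z; infer_instance
  rw [hof]
  refine EdgeMatrices.ext rfl rfl (eq_of_binary ?_ (reduce_dir_binary hG) ?_)
    (eq_of_binary (ind_binary _) (ind_binary _) ?_) rfl
  · intro i k
    dsimp only
    have h1 : k ∈ G.uSet C M → k ∉ G.vSet C M := uSet_not_mem_vSet hG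
    by_cases hk : k ∈ G.uSet C M
    · have h2 : ind (blk (G.uSet C M) (G.vSet C M) D
          + blk (G.uSet C M) (G.lSet C M) D * blk (G.lSet C M) (G.vSet C M) (G.Z C M)) i k = 0 := by
        by_contra h
        rw [← Ne, ind_ne_zero, add_ne_zero, mul_ne_zero] at h
        simp only [blk_ne_zero] at h
        have := h1 hk
        -- The two summands of the arrow matrix occupy disjoint columns, `u` and `v`, so their sum
        -- is binary although `In` is applied only to the second.
        tauto
      rw [Matrix.add_apply, h2, add_zero]
      exact blk_binary (zer_binary _ _ i k)
    · have h2 : blk (G.uSet C M) (G.uSet C M) D i k = 0 := by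
        by_contra h
        exact hk (blk_ne_zero.1 h).2.1
      rw [Matrix.add_apply, h2, zero_add]
      exact ind_binary _ i k
  · intro i k
    rw [reduce_dir_ne_zero hG]
    simp only [add_ne_zero, mul_ne_zero, blk_ne_zero, ind_ne_zero]
    constructor
    · rintro (⟨hi, hk, h⟩ | ⟨hi, hk, h⟩ | ⟨y, ⟨hi, hy, h1⟩, -, hk, h2⟩)
      · exact ⟨hi, .inl hk, (full_parentGraph_inl_inr hA hi).2 (.inl h)⟩
      · exact ⟨hi, .inr hk, (full_parentGraph_inl_inr hA hi).2 (.inl h)⟩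
      · exact ⟨hi, .inr hk, (full_parentGraph_inl_inr hA hi).2 (.inr ⟨y, hy, h1,
          (Z_ne_zero hG (lSet_subset_phiSet hy) (vSet_subset_phiSet hk)).1 h2⟩)⟩
    · rintro ⟨hi, hk | hk, h⟩
      · refine .inl ⟨hi, hk, (zer_parent_ne_zero hA hi).2 ?_⟩
        exact (full_inl_inr_of_mem_oSet hG (uSet_subset_oSet hk)).1 h
      · rcases (full_parentGraph_inl_inr hA hi).1 h with h | ⟨y, hy, h1, h2⟩
        · exact .inr (.inl ⟨hi, hk, h⟩)
        · exact .inr (.inr ⟨y, ⟨hi, hy, h1⟩, hy, hk,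
            (Z_ne_zero hG (lSet_subset_phiSet hy) (vSet_subset_phiSet hk)).2 h2⟩)
  · intro i j
    rw [reduce_dash_ne_zero hG]
    simp only [ind_ne_zero, add_ne_zero, mul_ne_zero, blk_ne_zero, transpose_ne_zero,
      one_ne_zero_iff]
    constructor
    · rintro ((⟨hi, hj, h⟩ | ⟨x, ⟨hi, hx, h1⟩, hj, -, h2⟩) |
        ⟨q, ⟨p, ⟨hi, hp, h1⟩, -, hq, h2⟩, hj, -, h3⟩)
      · exact ⟨hi, hj, (dash_parentGraph_ne_zero hA hi hj).2 (.inl h)⟩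
      · exact ⟨hi, hj, (dash_parentGraph_ne_zero hA hi hj).2 (.inr (.inl ⟨x, hx, h1, h2⟩))⟩
      · exact ⟨hi, hj, (dash_parentGraph_ne_zero hA hi hj).2
          (.inr (.inr ⟨p, hp, q, hq, h1, h2, h3⟩))⟩
    · rintro ⟨hi, hj, h⟩
      rcases (dash_parentGraph_ne_zero hA hi hj).1 h with h | ⟨x, hx, h1, h2⟩ |
        ⟨p, hp, q, hq, h1, h2, h3⟩
      · exact .inl (.inl ⟨hi, hj, h⟩)
      · exact .inl (.inr ⟨x, ⟨hi, hx, h1⟩, hj, hx, h2⟩)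
      · exact .inr ⟨q, ⟨p, ⟨hi, hp, h1⟩, hp, hq, h2⟩, hj, hq, h3⟩

end Parent

end SummaryGraphs

open SummaryGraphs in
theorem corollary5 {V : Type*} [Fintype V] [LinearOrder V] :
    -- the components for `[C, M]` result from those for `[c, m]`
    (∀ A : Matrix V V ℝ, IsParentEdgeMatrix A →
      ∀ c m C M : Finset V, c ⊆ C → m ⊆ M → Disjoint C M →
        IsSummaryGraph (ofParent A C M) ∧
        (ofParent A C M).nodes = (C ∪ M)ᶜ ∧
        ofParent A C M = (ofParent A c m).reduce (C \ c) (M \ m)) ∧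
    -- summary graphs are closed under conditioning and marginalising
    (∀ G : EdgeMatrices V, IsSummaryGraph G →
      ∀ c m : Finset V, c ⊆ G.nodes → m ⊆ G.nodes → Disjoint c m →
        IsSummaryGraph (G.reduce c m) ∧
        (G.reduce c m).nodes = G.nodes \ (c ∪ m)) ∧
    -- in any order and in any number of steps
    (∀ G : EdgeMatrices V, IsSummaryGraph G →
      ∀ c₁ m₁ c₂ m₂ : Finset V,
        c₁ ⊆ G.nodes → m₁ ⊆ G.nodes → c₂ ⊆ G.nodes → m₂ ⊆ G.nodes →
        Disjoint c₁ c₂ → Disjoint m₁ m₂ → Disjoint (c₁ ∪ c₂) (m₁ ∪ m₂) →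
        (G.reduce c₁ m₁).reduce c₂ m₂ = G.reduce (c₁ ∪ c₂) (m₁ ∪ m₂)) := by
  refine ⟨fun A hA c m C M hc hm hd => ?_, fun G hG c m _ _ _ =>
    ⟨EdgeMatrices.isSummaryGraph_reduce hG, EdgeMatrices.nodes_reduce⟩,
    fun G hG c₁ m₁ c₂ m₂ _ _ _ _ _ _ hd => EdgeMatrices.reduce_reduce hG hd⟩
  have hG := isSummaryGraph_parentGraph hA
  -- Both generated graphs become reductions of the parent graph, so the comparison is a two-step
  -- reduction.
  rw [ofParent_eq_reduce hA, ofParent_eq_reduce hA]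
  refine ⟨EdgeMatrices.isSummaryGraph_reduce hG, ?_, ?_⟩
  · rw [EdgeMatrices.nodes_reduce]
    ext i
    simp [mem_nodes_parentGraph]
  · have hC := Finset.union_sdiff_of_subset hc
    have hM := Finset.union_sdiff_of_subset hm
    rw [EdgeMatrices.reduce_reduce hG (by rwa [hC, hM]), hC, hM]
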